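/- **Setting.** Let $N\ge 1$, $n=\lfloor N/2\rfloor$, and let $E=\mathbb C^N$ with basis $e_1,\dots,e_N$ carry the symmetric bilinear form $(e_i,e_j)=\delta_{i+j,N+1}$. Let $pr_k:E\to E$ be the projection along $e_k$ onto the span of the other basis vectors. The orthogonal degenerate flag variety $SOF^a_N\subset \mathrm{Gr}(1,E)\times\dots\times\mathrm{Gr}(n,E)$ is the set of collections $(V_1,\dots,V_n)$ of subspaces of $E$ with $\dim V_k=k$ for all $k$, $pr_{k+1}V_k\subset V_{k+1}$ for $1\le k<n$, and $(V_n,V_n)=0$ if $N$ is even, $(V_n,pr_{n+1}V_n)=0$ if $N$ is odd (no condition if $n=0$). Let $\mathcal I_N$ be the set of collections $\mathbf I=(I_1,\dots,I_n)$ of subsets of $\{1,\dots,N\}$ with $|I_k|=k$, $I_k\subset I_{k+1}\cup\{k+1\}$ for $1\le k<n$, and such that $a\in I_n$, $a\ne N+1-a$ imply $N+1-a\notin I_n$. For $1\le k\le n$ order $\{1,\dots,N\}$ by $k+1<_k k+2<_k\dots<_k N<_k 1<_k\dots<_k k$. For $\mathbf I\in\mathcal I_N$ let $C(\mathbf I)$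 be the set of those $(V_1,\dots,V_n)\in SOF^a_N$ such that every $V_k$ has a basis of the form $e_a+\sum_{b<_k a}c_{a,b}e_b$, $a\in I_k$, with $c_{a,b}\in\mathbb C$. A Dellac configuration $D\in DC_N$ is a set of $2N$ boxes (called points) of a tableau with $N$ columns and $2N$ rows, with exactly one point in each row and exactly two points in each column, such that $j\le i\le N+j$ for each point $(j,i)$ ($j$ is the column, $i$ the row). Let $R(j,i)=(N+1-j,2N+1-i)$ and let $SDC_N$ be the set of $D\in DC_N$ with $R(D)=D$. An inversion of $D$ is a pair $(p,p')$ of points $p=(j,i)$, $p'=(j',i')$ of $D$ with $j<j'$ and $i>i'$; it is centrally symmetric if $p'=R(p)$. For $D\in SDC_N$ let $\widetilde{inv}'(D)$ be half of the number of inversions of $D$ that are not centrally symmetric. To $\mathbf I\in\mathcal I_N$ one attaches $S(\mathbf I)\in SDC_N$ as follows. An element $a\in I_k$ is initiating if $a=k$ or $a\notin I_{k-1}$ (with $I_0=\emptyset$). For every $1\le k\le n$ and every initiating $a\in I_k$ put a point in the box $(k,a)$ if $a>k$ and in the box $(k,N+a)$ if $a\le k$; then, for every $i\in\{1,\dots,n\}$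 such that row $i$ is still empty, put a point in the box $(i,i)$; then add the images under $R$ of all these points; finally, if $N$ is odd, put points in the middle column $n+1$ in all rows that are still empty. **Theorem.** For every $\mathbf I\in\mathcal I_N$ the configuration $S(\mathbf I)$ belongs to $SDC_N$, and $C(\mathbf I)$ is an affine cell, i.e. a locally closed subvariety of $\mathrm{Gr}(1,E)\times\dots\times\mathrm{Gr}(n,E)$ isomorphic to an affine space $\mathbb A^d$; its dimension is $d=\widetilde{inv}'(S(\mathbf I))$. The variety $SOF^a_N$ is the disjoint union of the cells $C(\mathbf I)$ over all $\mathbf I\in\mathcal I_N$. -/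

import Mathlib

namespace DegFlag

/-! Conventions. The vector space is `E = Fin N → ℂ` with its standard basis; the basis vector
`e_i` of the mathematics (`1 ≤ i ≤ N`) is the one with index `i - 1 : Fin N`. With `n = N / 2`
(the floor of `N / 2`), a collection `(V_1, …, V_n)` is a function on `Fin n`, the space `V_k`
having index `k - 1`; the same for collections of sets `(I_1, …, I_n)`. Points of tableaux are
pairs (column, row) of natural numbers counted from `1`. -/

/-- The symmetric bilinear form with `(e_i, e_j) = δ_{i+j, N+1}`. -/
noncomputable def form (N : ℕ) (x y : Fin N → ℂ) : ℂ := ∑ i, x i * y (Fin.rev i)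

/-- The projection along the basis vector with index `i` onto the span of the other ones. -/
def pr (N : ℕ) (i : Fin N) : (Fin N → ℂ) →ₗ[ℂ] (Fin N → ℂ) where
  toFun x := fun j => if j = i then 0 else x j
  map_add' x y := by
    funext j
    by_cases h : j = i <;> simp [h]
  map_smul' c x := by
    funext j
    by_cases h : j = i <;> simp [h]

/-- Collections `(V_1, …, V_n)` of subspaces of `ℂ ^ N`, where `n = ⌊N / 2⌋`. -/
abbrev Coll (N : ℕ) := Fin (N / 2) → Submodule ℂ (Fin N → ℂ)

/-- The orthogonal degenerate flag variety: `dim V_k = k`, `pr_{k+1} V_k ⊆ V_{k+1}`, and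
`(V_n, V_n) = 0` for even `N`, `(V_n, pr_{n+1} V_n) = 0` for odd `N`. (The last two conditions are
void if `n = 0`.) -/
def SOF (N : ℕ) : Set (Coll N) :=
  {V | (∀ k, Module.finrank ℂ (V k) = (k : ℕ) + 1) ∧
    (∀ (k : ℕ) (h : k + 1 < N / 2),
      (V ⟨k, by omega⟩).map (pr N ⟨k + 1, by omega⟩) ≤ V ⟨k + 1, h⟩) ∧
    (∀ k : Fin (N / 2), (k : ℕ) + 1 = N / 2 →
      (Even N → ∀ x ∈ V k, ∀ y ∈ V k, form N x y = 0) ∧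
      (Odd N → ∀ x ∈ V k, ∀ y ∈ V k,
        form N x (pr N ⟨N / 2, by have := k.2; omega⟩ y) = 0))}

/-- The index set of the coordinate flags in `SOF N`: collections `(I_1, …, I_n)` of subsets of
`{1, …, N}` with `|I_k| = k`, `I_k ⊆ I_{k+1} ∪ {k+1}`, and such that `a ∈ I_n` implies
`N + 1 - a ∉ I_n` whenever `a ≠ N + 1 - a`. -/
def indexSet (N : ℕ) : Set (Fin (N / 2) → Finset (Fin N)) :=
  {I | (∀ k, (I k).card = (k : ℕ) + 1) ∧
    (∀ (k : ℕ) (h : k + 1 < N / 2),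
      I ⟨k, by omega⟩ ⊆ insert (⟨k + 1, by omega⟩ : Fin N) (I ⟨k + 1, h⟩)) ∧
    (∀ k : Fin (N / 2), (k : ℕ) + 1 = N / 2 →
      ∀ a ∈ I k, a ≠ Fin.rev a → Fin.rev a ∉ I k)}

/-- For `1 ≤ k ≤ n` and `1 ≤ l ≤ N` the number `l_k`, which is `l` if `l > k` and `N + l` otherwise
(here `k` and `l` are given by their zero-based indices). -/
def rowLabel (N : ℕ) (k : Fin (N / 2)) (l : Fin N) : ℕ :=
  if (k : ℕ) < (l : ℕ) then (l : ℕ) + 1 else N + ((l : ℕ) + 1)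

/-- The order `k+1 <_k k+2 <_k ⋯ <_k N <_k 1 <_k ⋯ <_k k` on `{1, …, N}`. -/
def lowerThan (N : ℕ) (k : Fin (N / 2)) (b a : Fin N) : Prop :=
  rowLabel N k b < rowLabel N k a

instance (N : ℕ) (k : Fin (N / 2)) (b a : Fin N) : Decidable (lowerThan N k b a) :=
  inferInstanceAs (Decidable (_ < _))

/-- The cell `C(I)`: the points `(V_1, …, V_n)` of `SOF N` such that every `V_k` has a basis of the
form `e_a + ∑_{b <_k a} c_{a,b} e_b`, `a ∈ I_k`. -/
def cell (N : ℕ) (I : Fin (N / 2) → Finset (Fin N)) : Set (Coll N) :=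
  {V | V ∈ SOF N ∧ ∀ k, ∃ (B : Module.Basis (I k) ℂ (V k)) (c : Fin N → Fin N → ℂ),
    ∀ a : I k, ((B a : V k) : Fin N → ℂ) =
      Pi.single (a : Fin N) (1 : ℂ) +
        ∑ b ∈ Finset.univ.filter (fun b => lowerThan N k b a),
          c a b • (Pi.single b (1 : ℂ) : Fin N → ℂ)}

/-! ### Symmetric Dellac configurations -/

/-- The central reflection of the tableau with `N` columns and `2 N` rows. -/
def reflect (N : ℕ) (p : ℕ × ℕ) : ℕ × ℕ := (N + 1 - p.1, 2 * N + 1 - p.2)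

/-- Dellac configurations with `N` columns and `2 N` rows, as sets of points (column, row). -/
structure IsDellac (N : ℕ) (D : Finset (ℕ × ℕ)) : Prop where
  inside : ∀ p ∈ D, 1 ≤ p.1 ∧ p.1 ≤ N ∧ p.1 ≤ p.2 ∧ p.2 ≤ N + p.1
  row : ∀ i ∈ Finset.Icc 1 (2 * N), (D.filter (fun p => p.2 = i)).card = 1
  column : ∀ j ∈ Finset.Icc 1 N, (D.filter (fun p => p.1 = j)).card = 2

/-- The set of symmetric Dellac configurations. -/
def SDC (N : ℕ) : Set (Finset (ℕ × ℕ)) := {D | IsDellac N D ∧ D.image (reflect N) = D}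

/-- The inversions of `D` (pairs `((j, i), (j', i'))` of points with `j < j'` and `i > i'`) that are
not symmetric with respect to the center, i.e. not of the form `(p, reflect p)`. -/
def asymInversions (N : ℕ) (D : Finset (ℕ × ℕ)) : Finset ((ℕ × ℕ) × (ℕ × ℕ)) :=
  (D ×ˢ D).filter (fun q => q.1.1 < q.2.1 ∧ q.2.2 < q.1.2 ∧ q.2 ≠ reflect N q.1)

/-- Half of the number of inversions that are not symmetric with respect to the center. -/
def invTilde' (N : ℕ) (D : Finset (ℕ × ℕ)) : ℚ := ((asymInversions N D).card : ℚ) / 2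

/-- `a ∈ I_k` is initiating if `a = k` or `a ∉ I_{k-1}`, where `I_0 = ∅`. -/
def Initiating (N : ℕ) (I : Fin (N / 2) → Finset (Fin N)) (k : Fin (N / 2)) (a : Fin N) : Prop :=
  a ∈ I k ∧ ((a : ℕ) = (k : ℕ) ∨ ∀ j : Fin (N / 2), (j : ℕ) + 1 = (k : ℕ) → a ∉ I j)

instance (N : ℕ) (I : Fin (N / 2) → Finset (Fin N)) (k : Fin (N / 2)) (a : Fin N) :
    Decidable (Initiating N I k a) :=
  inferInstanceAs (Decidable (_ ∧ _))

/-- The points `(k, a_k)` for `a` initiating in `I_k`, `1 ≤ k ≤ n`. -/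
def bluePoints (N : ℕ) (I : Fin (N / 2) → Finset (Fin N)) : Finset (ℕ × ℕ) :=
  (Finset.univ.filter (fun q : Fin (N / 2) × Fin N => Initiating N I q.1 q.2)).image
    (fun q => ((q.1 : ℕ) + 1, rowLabel N q.1 q.2))

/-- The diagonal points `(i, i)` in those of the rows `1, …, n` that hold no blue point. -/
def redPoints (N : ℕ) (I : Fin (N / 2) → Finset (Fin N)) : Finset (ℕ × ℕ) :=
  ((Finset.Icc 1 (N / 2)).filter (fun i => ∀ p ∈ bluePoints N I, p.2 ≠ i)).image
    (fun i => (i, i))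

/-- The points in the first `n` and in the last `n` columns of `S(I)`. -/
def outerPoints (N : ℕ) (I : Fin (N / 2) → Finset (Fin N)) : Finset (ℕ × ℕ) :=
  (bluePoints N I ∪ redPoints N I) ∪ (bluePoints N I ∪ redPoints N I).image (reflect N)

/-- The configuration `S(I)`. For odd `N` the middle column `n + 1` holds the points of all the rows
that have no point in the other columns; for even `N` there is no middle column. -/
def dellac (N : ℕ) (I : Fin (N / 2) → Finset (Fin N)) : Finset (ℕ × ℕ) :=
  outerPoints N I ∪
    if Odd N then
      ((Finset.Icc 1 (2 * N)).filter (fun i => ∀ p ∈ outerPoints N I, p.2 ≠ i)).image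
        (fun i => (N / 2 + 1, i))
    else ∅

/-! ### The variety structure on the product of Grassmannians

The product `Gr(1, N) × ⋯ × Gr(n, N)` is the quotient of the variety of collections of matrices of
sizes `N × 1, …, N × n` with linearly independent columns by `GL_1 × ⋯ × GL_n`. Hence its Zariski
topology and its regular functions are given in terms of the entries of such matrices. -/

/-- Positions of the entries of a collection of matrices of sizes `N × 1, …, N × n`. -/
abbrev FrameIndex (N : ℕ) := Σ k : Fin (N / 2), Fin N × Fin ((k : ℕ) + 1)

/-- The columns of the matrix with index `k` in the collection `M`. -/
def frameVec (N : ℕ) (M : FrameIndex N → ℂ) (k : Fin (N / 2)) (j : Fin ((k : ℕ) + 1)) :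
    Fin N → ℂ :=
  fun r => M ⟨k, (r, j)⟩

/-- For every `k` the columns of the matrix with index `k` form a basis of `V k`. -/
def IsFrameOf (N : ℕ) (M : FrameIndex N → ℂ) (V : Coll N) : Prop :=
  ∀ k, LinearIndependent ℂ (frameVec N M k) ∧
    Submodule.span ℂ (Set.range (frameVec N M k)) = V k

/-- Zariski closed subsets of `Gr(1, N) × ⋯ × Gr(n, N)`. -/
def IsZariskiClosed (N : ℕ) (Y : Set (Coll N)) : Prop :=
  (∀ V ∈ Y, ∀ k, Module.finrank ℂ (V k) = (k : ℕ) + 1) ∧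
  ∃ P : Set (MvPolynomial (FrameIndex N) ℂ), ∀ V M, IsFrameOf N M V →
    (V ∈ Y ↔ ∀ p ∈ P, MvPolynomial.eval M p = 0)

/-- Zariski locally closed subsets, i.e. differences of two closed ones. -/
def IsZariskiLocallyClosed (N : ℕ) (Z : Set (Coll N)) : Prop :=
  ∃ Y Y' : Set (Coll N), IsZariskiClosed N Y ∧ IsZariskiClosed N Y' ∧ Z = Y \ Y'

/-- Regular functions on a locally closed subset `Z` of `Gr(1, N) × ⋯ × Gr(n, N)`: near every point
the function is a quotient of two polynomials in the entries of a collection of matrices that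
represents the point. -/
def IsRegularFunction (N : ℕ) (Z : Set (Coll N)) (f : Z → ℂ) : Prop :=
  ∀ (V₀ : Z) (M₀ : FrameIndex N → ℂ), IsFrameOf N M₀ V₀ →
    ∃ p q : MvPolynomial (FrameIndex N) ℂ, MvPolynomial.eval M₀ q ≠ 0 ∧
      ∀ (V : Z) (M : FrameIndex N → ℂ), IsFrameOf N M V → MvPolynomial.eval M q ≠ 0 →
        f V = MvPolynomial.eval M p / MvPolynomial.eval M q

/-- Morphisms of varieties from the affine space `𝔸 ^ d` to `Gr(1, N) × ⋯ × Gr(n, N)`: Zariski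
locally on the source, the map sends `t` to the column spaces of matrices of polynomials in `t`
with linearly independent columns. -/
def IsRegularParam (N d : ℕ) (φ : (Fin d → ℂ) → Coll N) : Prop :=
  ∀ t₀ : Fin d → ℂ, ∃ (q : MvPolynomial (Fin d) ℂ)
    (F : FrameIndex N → MvPolynomial (Fin d) ℂ), MvPolynomial.eval t₀ q ≠ 0 ∧
      ∀ t, MvPolynomial.eval t q ≠ 0 → IsFrameOf N (fun s => MvPolynomial.eval t (F s)) (φ t)

/-- `Z` is an affine cell of dimension `d`: a locally closed subvariety of
`Gr(1, N) × ⋯ × Gr(n, N)` that is isomorphic, as a variety, to the affine space `𝔸 ^ d`. -/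
def IsAffineCell (N d : ℕ) (Z : Set (Coll N)) : Prop :=
  IsZariskiLocallyClosed N Z ∧
  ∃ φ : (Fin d → ℂ) ≃ Z, IsRegularParam N d (fun t => (φ t : Coll N)) ∧
    ∀ j : Fin d, IsRegularFunction N Z (fun V => φ.symm V j)

end DegFlag

set_option linter.unusedSectionVars false

/-! The order `<_k` ranks the coordinates by `rowLabel N k`. Relative to such a ranking every
subspace has a well-defined set of leading positions (`leadSet`) and a unique reduced echelon basis.
A cell is the set of points of `SOF N` with prescribed leading positions (`mem_cell_iff`). Hence the
cells are disjoint, and they cover because the leading positions of a point are admissible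
(`leadSet_mem_indexSet`).

A point of the cell of `I` amounts to a family of reduced echelon matrices subject to the incidence
and isotropy equations (`IsValid`), which can be solved from the largest space downwards. In `V_n`,
pairing the basis vectors with leads `a ≤ a'` yields the entry of the vector of `a` at the dual of
`a'`. For `k < n`, incidence expresses the projected vectors of `V_k` through the basis of
`V_{k+1}`, which leaves a choice only in the columns of `I_{k+1} ∪ {k+1}`. The remaining entries
(`IsFree`) are arbitrary (`coef_isValid`) and determine all the others (`IsValid.eq_of_free`),
polynomially. This gives `cellEquiv`; its inverse is regular by Cramer's rule, the minors with rows
in `I_k` being nonzero on the cell. The same minors give local closedness.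

For the dimension: the first `m` columns of `S(I)` occupy exactly the rows `1, …, m` and the labels
of `I_m` (`rowsUpTo`, `mem_leftPoints`). A free entry `(k, a, b)` thus says that the row of `a` is
occupied within the first `k` columns, that the smaller row of `b` is not, and, if `k < n`, that the
latter is occupied in column `k+1`. This is an inversion. For `k = n` the condition on `Fin.rev b`
makes the count pick exactly one inversion from each pair exchanged by the central reflection
(`card_asymInversions`, `card_freeSet`). -/

namespace DegFlag

/-! ### Leading positions and reduced echelon bases. -/

section Echelon

variable {ι : Type*} [Fintype ι] [DecidableEq ι]

open Classical in
/-- The positions of the leading entries (with respect to the ranking `r` of the coordinates) of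
the vectors of a subspace. -/
noncomputable def leadSet (r : ι → ℕ) (V : Submodule ℂ (ι → ℂ)) : Finset ι :=
  Finset.univ.filter fun a => ∃ v ∈ V, v a = 1 ∧ ∀ b, r a < r b → v b = 0

/-- A family of vectors indexed by `S` in reduced echelon form. -/
structure IsReduced {R : Type*} [Zero R] [One R] (r : ι → ℕ) (S : Finset ι) (v : ι → ι → R) :
    Prop where
  delta : ∀ a ∈ S, ∀ b ∈ S, v a b = if a = b then 1 else 0
  upper : ∀ a ∈ S, ∀ b, r a < r b → v a b = 0

lemma mem_leadSet {r : ι → ℕ} {V : Submodule ℂ (ι → ℂ)} {a : ι} :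
    a ∈ leadSet r V ↔ ∃ v ∈ V, v a = 1 ∧ ∀ b, r a < r b → v b = 0 := by
  simp [leadSet]

lemma exists_lead (r : ι → ℕ) {V : Submodule ℂ (ι → ℂ)} {w : ι → ℂ} (hw : w ∈ V) (h0 : w ≠ 0) :
    ∃ a ∈ leadSet r V, w a ≠ 0 ∧ ∀ b, r a < r b → w b = 0 := by
  classical
  obtain ⟨i, hi⟩ := Function.ne_iff.mp h0
  obtain ⟨a, ha, hmax⟩ := Finset.exists_max_image (Finset.univ.filter fun b => w b ≠ 0) r
    ⟨i, by simpa using hi⟩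
  have ha' : w a ≠ 0 := by simpa using ha
  have hup : ∀ b, r a < r b → w b = 0 := by
    intro b hb
    by_contra hne
    have := hmax b (by simpa using hne)
    omega
  refine ⟨a, mem_leadSet.mpr ⟨(w a)⁻¹ • w, V.smul_mem _ hw, ?_, ?_⟩, ha', hup⟩
  · simp [ha']
  · intro b hb
    simp [hup b hb]

lemma eq_zero_of_leadSet {r : ι → ℕ} {V : Submodule ℂ (ι → ℂ)} {w : ι → ℂ} (hw : w ∈ V)
    (h : ∀ a ∈ leadSet r V, w a = 0) : w = 0 := by
  by_contra h0
  obtain ⟨a, ha, hne, -⟩ := exists_lead r hw h0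
  exact hne (h a ha)

/-- The uniqueness principle used throughout: the highest nonzero coordinate of a difference of two
vectors of `V` would be a leading position. -/
lemma eq_of_leadSet {r : ι → ℕ} {V : Submodule ℂ (ι → ℂ)} {w w' : ι → ℂ} (hw : w ∈ V)
    (hw' : w' ∈ V) (h : ∀ a ∈ leadSet r V, w a = w' a) : w = w' :=
  sub_eq_zero.mp (eq_zero_of_leadSet (r := r) (V.sub_mem hw hw')
    fun a ha => by simp [h a ha])

/-- The restriction of the vectors of a subspace to a set of coordinates. -/
def restrictTo (S : Finset ι) (V : Submodule ℂ (ι → ℂ)) : V →ₗ[ℂ] (S → ℂ) :=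
  (LinearMap.funLeft ℂ ℂ (Subtype.val : S → ι)).comp V.subtype

lemma restrictTo_injective (r : ι → ℕ) (V : Submodule ℂ (ι → ℂ)) :
    Function.Injective (restrictTo (leadSet r V) V) := by
  intro x y h
  exact Subtype.ext (eq_of_leadSet (r := r) x.2 y.2 fun a ha => congrFun h ⟨a, ha⟩)

lemma linearIndependent_of_triangular {r : ι → ℕ} (hr : Function.Injective r) {S : Finset ι}
    {v : S → ι → ℂ} (h1 : ∀ a : S, v a a = 1) (h2 : ∀ (a : S) b, r a < r b → v a b = 0) :
    LinearIndependent ℂ v := by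
  classical
  rw [Fintype.linearIndependent_iff]
  intro g hg
  by_contra! hne
  obtain ⟨i, hi⟩ := hne
  obtain ⟨a, ha, hmax⟩ := Finset.exists_max_image (Finset.univ.filter fun b => g b ≠ 0)
    (fun b => r b) ⟨i, by simpa using hi⟩
  have ha' : g a ≠ 0 := by simpa using ha
  have := congrFun hg a
  rw [Finset.sum_apply, Finset.sum_eq_single a] at this
  · simp [h1, ha'] at this
  · intro b _ hb
    by_cases hgb : g b = 0
    · simp [hgb]
    · have hle := hmax b (by simpa using hgb)
      have hlt : r b < r a := lt_of_le_of_ne hle fun e => hb (Subtype.ext (hr e))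
      simp [h2 b a hlt]
  · simp

/-- Vectors with distinct leads are triangular, hence independent; conversely the coordinates in the
leading positions embed `V`. -/
lemma card_leadSet {r : ι → ℕ} (hr : Function.Injective r) (V : Submodule ℂ (ι → ℂ)) :
    (leadSet r V).card = Module.finrank ℂ V := by
  apply le_antisymm
  · choose! u hu hu1 hu2 using fun a (ha : a ∈ leadSet r V) => mem_leadSet.mp ha
    have hli : LinearIndependent ℂ (fun a : leadSet r V => (⟨u a, hu a a.2⟩ : V)) := by
      apply LinearIndependent.of_comp V.subtype
      exact linearIndependent_of_triangular hr (fun a => hu1 a a.2) fun a b h => hu2 a a.2 b h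
    simpa using hli.fintype_card_le_finrank
  · simpa using LinearMap.finrank_le_finrank_of_injective (restrictTo_injective r V)

/-- By the dimension count, restriction to the leading coordinates is bijective; the basis consists
of the preimages of the unit vectors. -/
lemma exists_reduced {r : ι → ℕ} (hr : Function.Injective r) (V : Submodule ℂ (ι → ℂ)) :
    ∃ v : ι → ι → ℂ, IsReduced r (leadSet r V) v ∧ ∀ a ∈ leadSet r V, v a ∈ V := by
  have hinj := restrictTo_injective r V
  have hsurj : Function.Surjective (restrictTo (leadSet r V) V) :=
    (LinearMap.injective_iff_surjective_of_finrank_eq_finrank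
      (by simp [card_leadSet hr V])).mp hinj
  have key : ∀ a : ι, ∃ w ∈ V, ∀ b ∈ leadSet r V, w b = if a = b then 1 else 0 := by
    intro a
    obtain ⟨w, hw⟩ := hsurj fun b => if a = b then 1 else 0
    exact ⟨w, w.2, fun b hb => congrFun hw ⟨b, hb⟩⟩
  choose v hv hd using key
  refine ⟨v, ⟨fun a _ b hb => hd a b hb, fun a ha b hab => ?_⟩, fun a _ => hv a⟩
  have h0 : v a ≠ 0 := by
    intro h
    have := hd a a ha
    simp [h] at this
  -- The lead of `v a` is a leading position where `v a` does not vanish, and `a` is the only such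
  -- position.
  obtain ⟨c, hc, hne, hup⟩ := exists_lead r (hv a) h0
  have : a = c := by
    by_contra hac
    exact hne (by rw [hd a c hc, if_neg hac])
  subst this
  exact hup b hab

/-- The reduced echelon basis of a subspace. -/
noncomputable def reduced {r : ι → ℕ} (hr : Function.Injective r) (V : Submodule ℂ (ι → ℂ)) :
    ι → ι → ℂ := (exists_reduced hr V).choose

lemma reduced_isReduced {r : ι → ℕ} (hr : Function.Injective r) (V : Submodule ℂ (ι → ℂ)) :
    IsReduced r (leadSet r V) (reduced hr V) := (exists_reduced hr V).choose_spec.1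

lemma reduced_mem {r : ι → ℕ} (hr : Function.Injective r) (V : Submodule ℂ (ι → ℂ)) {a : ι}
    (ha : a ∈ leadSet r V) : reduced hr V a ∈ V := (exists_reduced hr V).choose_spec.2 a ha

lemma reduced_unique {r : ι → ℕ} (hr : Function.Injective r) {V : Submodule ℂ (ι → ℂ)}
    {v : ι → ι → ℂ} (hv : IsReduced r (leadSet r V) v) {a : ι} (ha : a ∈ leadSet r V)
    (hm : v a ∈ V) : reduced hr V a = v a :=
  eq_of_leadSet (r := r) (reduced_mem hr V ha) hm fun b hb => by
    rw [hv.delta a ha b hb, (reduced_isReduced hr V).delta a ha b hb]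

lemma eq_sum_reduced {r : ι → ℕ} (hr : Function.Injective r) {V : Submodule ℂ (ι → ℂ)}
    {w : ι → ℂ} (hw : w ∈ V) : w = ∑ a ∈ leadSet r V, w a • reduced hr V a := by
  refine eq_of_leadSet (r := r) hw
    (V.sum_mem fun a ha => V.smul_mem _ (reduced_mem hr V ha)) fun b hb => ?_
  rw [Finset.sum_apply, Finset.sum_eq_single b]
  · simp [(reduced_isReduced hr V).delta b hb b hb]
  · intro a ha hab
    simp [(reduced_isReduced hr V).delta a ha b hb, hab]
  · exact fun h => absurd hb h

lemma span_reduced {r : ι → ℕ} (hr : Function.Injective r) (V : Submodule ℂ (ι → ℂ)) :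
    Submodule.span ℂ (reduced hr V '' leadSet r V) = V := by
  apply le_antisymm
  · rw [Submodule.span_le]
    rintro _ ⟨a, ha, rfl⟩
    exact reduced_mem hr V ha
  · intro w hw
    rw [eq_sum_reduced hr hw]
    exact Submodule.sum_mem _ fun a ha =>
      Submodule.smul_mem _ _ (Submodule.subset_span ⟨a, ha, rfl⟩)

lemma IsReduced.self {R : Type*} [Zero R] [One R] {r : ι → ℕ} {S : Finset ι} {v : ι → ι → R}
    (h : IsReduced r S v) {a : ι} (ha : a ∈ S) : v a a = 1 := by simp [h.delta a ha a ha]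

lemma IsReduced.linearIndependent {r : ι → ℕ} {S : Finset ι} {v : ι → ι → ℂ}
    (hr : Function.Injective r) (h : IsReduced r S v) :
    LinearIndependent ℂ (fun a : S => v a) :=
  linearIndependent_of_triangular hr (fun a => h.self a.2) fun a b hb => h.upper a a.2 b hb

lemma IsReduced.finrank_span {r : ι → ℕ} {S : Finset ι} {v : ι → ι → ℂ}
    (hr : Function.Injective r) (h : IsReduced r S v) :
    Module.finrank ℂ (Submodule.span ℂ (v '' S)) = S.card := by
  have := finrank_span_eq_card (h.linearIndependent hr)
  rw [Set.image_eq_range]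
  simpa using this

lemma IsReduced.leadSet_span {r : ι → ℕ} {S : Finset ι} {v : ι → ι → ℂ}
    (hr : Function.Injective r) (h : IsReduced r S v) :
    leadSet r (Submodule.span ℂ (v '' S)) = S := by
  symm
  apply Finset.eq_of_subset_of_card_le
  · intro a ha
    exact mem_leadSet.mpr ⟨v a, Submodule.subset_span ⟨a, ha, rfl⟩, h.self ha, h.upper a ha⟩
  · rw [card_leadSet hr, h.finrank_span hr]

lemma IsReduced.reduced_span {r : ι → ℕ} {S : Finset ι} {v : ι → ι → ℂ}
    (hr : Function.Injective r) (h : IsReduced r S v) {a : ι} (ha : a ∈ S) :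
    reduced hr (Submodule.span ℂ (v '' S)) a = v a := by
  have hS := h.leadSet_span hr
  exact reduced_unique hr (by rwa [hS]) (by rwa [hS]) (Submodule.subset_span ⟨a, ha, rfl⟩)

end Echelon

/-! ### The cyclic orders, and cells as loci of fixed leading positions. -/

variable {N : ℕ}

lemma rowLabel_injective (k : Fin (N / 2)) : Function.Injective (rowLabel N k) := by
  intro a b h
  simp only [rowLabel] at h
  ext
  have := a.2
  have := b.2
  split_ifs at h <;> omega

lemma le_rowLabel (k : Fin (N / 2)) (a : Fin N) : (k : ℕ) + 2 ≤ rowLabel N k a := by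
  have := k.2
  simp only [rowLabel]
  split_ifs <;> omega

lemma rowLabel_le (k : Fin (N / 2)) (a : Fin N) : rowLabel N k a ≤ N + (k : ℕ) + 1 := by
  have := a.2
  simp only [rowLabel]
  split_ifs <;> omega

/-- Below the top one, the orders for consecutive indices agree away from one element. -/
lemma rowLabel_succ {k : ℕ} (h : k + 1 < N / 2) {a : Fin N} (ha : (a : ℕ) ≠ k + 1) :
    rowLabel N ⟨k + 1, h⟩ a = rowLabel N ⟨k, by omega⟩ a := by
  simp only [rowLabel]
  split_ifs <;> omega

/-- For the last order, duality reverses the ranking of the positions that are not self-dual. This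
is what links isotropy to leading positions and, later, to the central reflection. -/
lemma rowLabel_rev {k : Fin (N / 2)} (hk : (k : ℕ) + 1 = N / 2) {a : Fin N} (ha : a ≠ Fin.rev a) :
    rowLabel N k (Fin.rev a) + rowLabel N k a = 2 * N + 1 := by
  have := a.2
  have h2 : (a : ℕ) ≠ Fin.rev a := fun e => ha (Fin.ext e)
  simp only [rowLabel, Fin.val_rev] at *
  split_ifs <;> omega

lemma monic_expansion_apply (k : Fin (N / 2)) (a b : Fin N) (c : Fin N → ℂ) :
    ((Pi.single a (1 : ℂ) : Fin N → ℂ) + ∑ b ∈ Finset.univ.filter (fun b => lowerThan N k b a),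
      c b • (Pi.single b (1 : ℂ) : Fin N → ℂ)) b =
      (if b = a then 1 else 0) + if lowerThan N k b a then c b else 0 := by
  simp only [Pi.add_apply, Finset.sum_apply, Pi.smul_apply, Pi.single_apply, smul_eq_mul,
    mul_ite, mul_one, mul_zero, Finset.sum_ite_eq, Finset.mem_filter, Finset.mem_univ, true_and]

/-- The bases in the definition of a cell need not be reduced, but their leads exhaust `leadSet` by
cardinality; conversely the reduced basis has the required form. -/
lemma mem_cell_iff {I : Fin (N / 2) → Finset (Fin N)} {V : Coll N} :
    V ∈ cell N I ↔ V ∈ SOF N ∧ ∀ k, leadSet (rowLabel N k) (V k) = I k := by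
  refine and_congr_right fun hV => forall_congr' fun k => ⟨?_, ?_⟩
  · rintro ⟨B, c, hB⟩
    have hval : ∀ (a : I k) (b : Fin N), ((B a : V k) : Fin N → ℂ) b =
        (if b = a then 1 else 0) + if lowerThan N k b a then c a b else 0 := by
      intro a b
      rw [hB a, monic_expansion_apply]
    symm
    apply Finset.eq_of_subset_of_card_le
    · intro a ha
      refine mem_leadSet.mpr ⟨B ⟨a, ha⟩, (B ⟨a, ha⟩).2, ?_, ?_⟩
      · rw [hval]
        simp [lowerThan]
      · intro b hb
        rw [hval, if_neg, if_neg, add_zero]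
        · exact not_lt.mpr hb.le
        · rintro rfl
          exact lt_irrefl _ hb
    · rw [card_leadSet (rowLabel_injective k), Module.finrank_eq_card_basis B]
      simp
  · intro h
    have hr := rowLabel_injective (N := N) k
    have hred := reduced_isReduced hr (V k)
    have hspan := span_reduced hr (V k)
    have hmem := fun a => reduced_mem hr (V k) (a := a)
    rw [h] at hred hspan hmem
    have hli : LinearIndependent ℂ (fun a : I k => (⟨reduced hr (V k) a, hmem a a.2⟩ : V k)) :=
      LinearIndependent.of_comp (V k).subtype (hred.linearIndependent hr)
    have hcard : Fintype.card (I k) = Module.finrank ℂ (V k) := by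
      rw [← card_leadSet hr, h]
      simp
    have : Nonempty (I k) := by
      rw [← Fintype.card_pos_iff, hcard, hV.1 k]
      omega
    refine ⟨basisOfLinearIndependentOfCardEqFinrank hli hcard, reduced hr (V k), fun a => ?_⟩
    rw [coe_basisOfLinearIndependentOfCardEqFinrank]
    ext b
    rw [monic_expansion_apply]
    rcases lt_trichotomy (rowLabel N k b) (rowLabel N k a) with hlt | heq | hgt
    · have : b ≠ a := by rintro rfl; exact lt_irrefl _ hlt
      simp [this, lowerThan, hlt]
    · obtain rfl := hr heq
      simp [hred.self a.2, lowerThan]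
    · have : b ≠ a := by rintro rfl; exact lt_irrefl _ hgt
      simp [this, lowerThan, hgt.not_gt, hred.upper a a.2 b hgt]

/-- The part of the form that does not involve the self-dual coordinate. -/
def middleForm {R : Type*} [CommRing R] (x y : Fin N → R) : R :=
  ∑ i ∈ Finset.univ.filter (fun i : Fin N => i ≠ Fin.rev i), x i * y (Fin.rev i)

lemma form_eq_middleForm (hN : Even N) (x y : Fin N → ℂ) : form N x y = middleForm x y := by
  rw [form, middleForm, Finset.filter_true_of_mem]
  intro i _ h
  have := congrArg Fin.val h
  rw [Fin.val_rev] at this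
  obtain ⟨m, rfl⟩ := hN
  omega

lemma form_pr_eq_middleForm (hN : Odd N) (h : N / 2 < N) (x y : Fin N → ℂ) :
    form N x (pr N ⟨N / 2, h⟩ y) = middleForm x y := by
  rw [form, middleForm, Finset.sum_filter]
  refine Finset.sum_congr rfl fun i _ => ?_
  have : (Fin.rev i = ⟨N / 2, h⟩) ↔ i = Fin.rev i := by
    simp only [Fin.ext_iff, Fin.val_rev]
    have := i.2
    have := Nat.odd_iff.mp hN
    omega
  by_cases hi : i = Fin.rev i
  · rw [if_neg (not_not.mpr hi)]
    simp [pr, this.mpr hi]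
  · simp [pr, this, hi]

/-- One bilinear form serves both parities: for even `N` no position is self-dual, and for odd `N`
the projection removes exactly the self-dual coordinate. -/
lemma mem_SOF_iff {V : Coll N} :
    V ∈ SOF N ↔ (∀ k, Module.finrank ℂ (V k) = (k : ℕ) + 1) ∧
    (∀ (k : ℕ) (h : k + 1 < N / 2), ∀ x ∈ V ⟨k, by omega⟩,
      pr N ⟨k + 1, by omega⟩ x ∈ V ⟨k + 1, h⟩) ∧
    (∀ k : Fin (N / 2), (k : ℕ) + 1 = N / 2 → ∀ x ∈ V k, ∀ y ∈ V k, middleForm x y = 0) := by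
  refine and_congr_right fun _ => and_congr ?_ ?_
  · refine forall_congr' fun k => forall_congr' fun h => ?_
    rw [Submodule.map_le_iff_le_comap]
    rfl
  · refine forall_congr' fun k => forall_congr' fun _ => ?_
    rcases Nat.even_or_odd N with hN | hN
    · simp [hN, Nat.not_odd_iff_even.mpr hN, form_eq_middleForm]
    · simp [hN, Nat.not_even_iff_odd.mpr hN, form_pr_eq_middleForm]

/-- The leading positions of a point of the variety form an admissible collection. -/
lemma leadSet_mem_indexSet {V : Coll N} (hV : V ∈ SOF N) :
    (fun k => leadSet (rowLabel N k) (V k)) ∈ indexSet N := by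
  obtain ⟨hdim, hinc, hiso⟩ := mem_SOF_iff.mp hV
  refine ⟨fun k => by rw [card_leadSet (rowLabel_injective k), hdim], ?_, ?_⟩
  · intro k h a ha
    rw [Finset.mem_insert]
    by_cases hak : (a : ℕ) = k + 1
    · exact Or.inl (Fin.ext hak)
    right
    -- The projection kills the only coordinate whose rank differs in the two orders, so it
    -- preserves the lead `a`.
    obtain ⟨v, hv, h1, hup⟩ := mem_leadSet.mp ha
    refine mem_leadSet.mpr ⟨_, hinc k h v hv, ?_, ?_⟩
    · simp [pr, Fin.ext_iff, hak, h1]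
    · intro b hb
      by_cases hbk : (b : ℕ) = k + 1
      · simp [pr, Fin.ext_iff, hbk]
      · rw [rowLabel_succ h hak, rowLabel_succ h hbk] at hb
        simp [pr, Fin.ext_iff, hbk, hup b hb]
  · intro k hk a ha hrev ha'
    obtain ⟨v, hv, h1, hup⟩ := mem_leadSet.mp ha
    obtain ⟨w, hw, h1', hup'⟩ := mem_leadSet.mp ha'
    have h0 := hiso k hk v hv w hw
    -- Since duality reverses the order, every term except the one at `a` has a factor beyond the
    -- lead of its vector; the surviving term is `1 * 1`.
    rw [middleForm, Finset.sum_eq_single a] at h0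
    · simp [h1, h1'] at h0
    · intro b hb hba
      have hb' : b ≠ Fin.rev b := by simpa using hb
      have e1 := rowLabel_rev hk hb'
      have e2 := rowLabel_rev hk hrev
      rcases lt_trichotomy (rowLabel N k b) (rowLabel N k a) with hlt | heq | hgt
      · rw [hup' _ (by omega), mul_zero]
      · exact absurd (rowLabel_injective k heq) hba
      · rw [hup _ hgt, zero_mul]
    · intro h
      simp at h
      exact absurd h hrev

end DegFlag

/-! ### Equations of the echelon matrices and their free entries. -/

namespace DegFlag

variable {N : ℕ} {R : Type*} [CommRing R]

/-- The reduced echelon matrices `C k a` (the vectors with leading position `a`) of a point of the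
cell with index `I`. -/
structure IsValid (I : Fin (N / 2) → Finset (Fin N)) (C : Fin (N / 2) → Fin N → Fin N → R) :
    Prop where
  red : ∀ k, IsReduced (rowLabel N k) (I k) (C k)
  incid : ∀ (k : ℕ) (h : k + 1 < N / 2), ∀ a ∈ I ⟨k, by omega⟩, ∀ b : Fin N, (b : ℕ) ≠ k + 1 →
    C ⟨k, by omega⟩ a b = ∑ a' ∈ (I ⟨k + 1, h⟩).erase (⟨k + 1, by omega⟩ : Fin N),
      C ⟨k, by omega⟩ a a' * C ⟨k + 1, h⟩ a' b
  iso : ∀ k : Fin (N / 2), (k : ℕ) + 1 = N / 2 → ∀ a ∈ I k, ∀ a' ∈ I k,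
    middleForm (C k a) (C k a') = 0

lemma middleForm_map {S : Type*} [CommRing S] (f : R →+* S) (x y : Fin N → R) :
    f (middleForm x y) = middleForm (fun i => f (x i)) (fun i => f (y i)) := by
  simp [middleForm, map_sum]

lemma IsValid.map {S : Type*} [CommRing S] {I : Fin (N / 2) → Finset (Fin N)}
    {C : Fin (N / 2) → Fin N → Fin N → R} (h : IsValid I C) (f : R →+* S) :
    IsValid I (fun k a b => f (C k a b)) where
  red k := ⟨fun a ha b hb => by rw [(h.red k).delta a ha b hb]; split_ifs <;> simp,
    fun a ha b hb => by rw [(h.red k).upper a ha b hb, map_zero]⟩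
  incid k hk a ha b hb := by
    rw [h.incid k hk a ha b hb]
    simp [map_sum]
  iso k hk a ha a' ha' := by rw [← middleForm_map, h.iso k hk a ha a' ha', map_zero]

/-- The entries of the reduced echelon matrices that serve as coordinates on the cell. -/
def IsFree (I : Fin (N / 2) → Finset (Fin N)) (k : Fin (N / 2)) (a b : Fin N) : Prop :=
  a ∈ I k ∧ b ∉ I k ∧ rowLabel N k b < rowLabel N k a ∧
    -- Below the top, incidence forces the entries in all other columns.
    (∀ h : (k : ℕ) + 1 < N / 2, b ∈ insert (⟨k + 1, by omega⟩ : Fin N) (I ⟨k + 1, h⟩)) ∧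
    -- Isotropy ties the entry of `a` at the dual of `a'` to the entry of `a'` at the dual of `a`:
    -- one of the two is kept as free, and none if `a = a'`.
    ((k : ℕ) + 1 = N / 2 → Fin.rev b ∈ I k → rowLabel N k (Fin.rev b) < rowLabel N k a)

/-- Pairs of dual positions none of which belongs to `S`. -/
def unpaired (S : Finset (Fin N)) : Finset (Fin N) :=
  Finset.univ.filter fun s => s ∉ S ∧ Fin.rev s ∉ S ∧ s ≠ Fin.rev s

/-- The positions that are not self-dual split into those in `S`, their duals and the unpaired ones;
on the first two parts one factor is a Kronecker delta. -/
lemma middleForm_reduced {S : Finset (Fin N)} {v : Fin N → Fin N → R}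
    (hS : ∀ a ∈ S, a ≠ Fin.rev a → Fin.rev a ∉ S)
    (hv : ∀ a ∈ S, ∀ b ∈ S, v a b = if a = b then 1 else 0) {a a' : Fin N} (ha : a ∈ S)
    (ha' : a' ∈ S) (hra : a ≠ Fin.rev a) (hra' : a' ≠ Fin.rev a') :
    middleForm (v a) (v a') =
      v a' (Fin.rev a) + v a (Fin.rev a') + ∑ s ∈ unpaired S, v a s * v a' (Fin.rev s) := by
  have hsplit : Finset.univ.filter (fun i : Fin N => i ≠ Fin.rev i) =
      (S.filter (fun i => i ≠ Fin.rev i) ∪ (S.filter (fun i => i ≠ Fin.rev i)).image Fin.rev) ∪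
        unpaired S := by
    ext i
    simp only [unpaired, Finset.mem_filter, Finset.mem_univ, true_and, Finset.mem_union,
      Finset.mem_image]
    constructor
    · intro hi
      by_cases h1 : i ∈ S
      · exact Or.inl (Or.inl ⟨h1, hi⟩)
      by_cases h2 : Fin.rev i ∈ S
      · exact Or.inl (Or.inr ⟨Fin.rev i, ⟨h2, by simpa using hi.symm⟩, by simp⟩)
      · exact Or.inr ⟨h1, h2, hi⟩
    · rintro ((⟨_, h⟩ | ⟨j, ⟨_, h⟩, rfl⟩) | ⟨_, _, h⟩)
      · exact h
      · simpa using h.symm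
      · exact h
  rw [middleForm, hsplit, Finset.sum_union, Finset.sum_union, Finset.sum_image]
  · congr 1
    congr 1
    · rw [Finset.sum_eq_single a]
      · simp [hv a ha a ha]
      · intro b hb hba
        rw [hv a ha b (Finset.mem_filter.mp hb).1, if_neg (Ne.symm hba), zero_mul]
      · exact fun h => absurd (Finset.mem_filter.mpr ⟨ha, hra⟩) h
    · rw [Finset.sum_eq_single a']
      · simp [hv a' ha' a' ha']
      · intro b hb hba
        rw [Fin.rev_rev, hv a' ha' b (Finset.mem_filter.mp hb).1, if_neg (Ne.symm hba), mul_zero]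
      · exact fun h => absurd (Finset.mem_filter.mpr ⟨ha', hra'⟩) h
  · exact fun x _ y _ h => Fin.rev_injective h
  · rw [Finset.disjoint_left]
    intro i hi hi'
    obtain ⟨j, hj, rfl⟩ := Finset.mem_image.mp hi'
    obtain ⟨hj1, hj2⟩ := Finset.mem_filter.mp hj
    exact hS j hj1 hj2 (Finset.mem_filter.mp hi).1
  · rw [Finset.disjoint_left]
    intro i hi hi'
    obtain ⟨-, h1, h2, -⟩ := Finset.mem_filter.mp hi'
    rcases Finset.mem_union.mp hi with h | h
    · exact h1 (Finset.mem_filter.mp h).1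
    · obtain ⟨j, hj, rfl⟩ := Finset.mem_image.mp h
      rw [Fin.rev_rev] at h2
      exact h2 (Finset.mem_filter.mp hj).1

/-- A self-dual leading position is the lowest one, so that its vector is a basis vector. -/
lemma rowLabel_lt_of_selfdual {k : Fin (N / 2)} (hk : (k : ℕ) + 1 = N / 2) {a b : Fin N}
    (ha : a = Fin.rev a) (hab : b ≠ a) : rowLabel N k a < rowLabel N k b := by
  have h1 := congrArg Fin.val ha
  have h2 : (b : ℕ) ≠ a := fun e => hab (Fin.ext e)
  have := a.2
  have := b.2
  simp only [rowLabel, Fin.val_rev] at *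
  split_ifs <;> omega

lemma middleForm_selfdual_left {k : Fin (N / 2)} (hk : (k : ℕ) + 1 = N / 2) {S : Finset (Fin N)}
    {v : Fin N → Fin N → R} (hv : IsReduced (rowLabel N k) S v) {a : Fin N} (ha : a ∈ S)
    (h : a = Fin.rev a) (y : Fin N → R) : middleForm (v a) y = 0 := by
  refine Finset.sum_eq_zero fun i hi => ?_
  have hia : i ≠ a := by
    rintro rfl
    exact (Finset.mem_filter.mp hi).2 h
  rw [hv.upper a ha i (rowLabel_lt_of_selfdual hk h hia), zero_mul]

lemma middleForm_selfdual_right {k : Fin (N / 2)} (hk : (k : ℕ) + 1 = N / 2) {S : Finset (Fin N)}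
    {v : Fin N → Fin N → R} (hv : IsReduced (rowLabel N k) S v) {a : Fin N} (ha : a ∈ S)
    (h : a = Fin.rev a) (x : Fin N → R) : middleForm x (v a) = 0 := by
  refine Finset.sum_eq_zero fun i hi => ?_
  have hia : Fin.rev i ≠ a := by
    rintro rfl
    rw [Fin.rev_rev] at h
    exact (Finset.mem_filter.mp hi).2 h.symm
  rw [hv.upper a ha _ (rowLabel_lt_of_selfdual hk h hia), mul_zero]

/-! ### Solving the equations for arbitrary free entries. -/

section Construction

variable [Algebra ℂ R] (I : Fin (N / 2) → Finset (Fin N)) (t : Fin (N / 2) → Fin N → Fin N → R)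

open Classical in
/-- The entries of the echelon matrices in the free positions and in the leading columns. -/
noncomputable def baseCoef (k : Fin (N / 2)) (a b : Fin N) : R :=
  if b ∈ I k then (if a = b then 1 else 0) else if IsFree I k a b then t k a b else 0

/-- The reduced echelon matrix of the isotropic subspace with given free entries. -/
noncomputable def topCoef (k : Fin (N / 2)) (a b : Fin N) : R :=
  if b ∈ I k ∨ Fin.rev b ∉ I k ∨ rowLabel N k (Fin.rev b) < rowLabel N k a then baseCoef I t k a b
  -- Pairing the vector of `a` with itself gives twice the entry at the dual of `a`, plus the sum;
  -- hence the factor `1 / 2`.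
  else if Fin.rev b = a then
    - (algebraMap ℂ R (1 / 2) *
      ∑ s ∈ unpaired (I k), baseCoef I t k a s * baseCoef I t k a (Fin.rev s))
  else - (baseCoef I t k (Fin.rev b) (Fin.rev a) +
      ∑ s ∈ unpaired (I k), baseCoef I t k a s * baseCoef I t k (Fin.rev b) (Fin.rev s))

/-- The reduced echelon matrix of a subspace, given the one of the next larger subspace. -/
noncomputable def stepCoef (k : Fin (N / 2)) (h : (k : ℕ) + 1 < N / 2) (C : Fin N → Fin N → R)
    (a b : Fin N) : R :=
  if b ∈ insert (⟨k + 1, by omega⟩ : Fin N) (I ⟨k + 1, h⟩) then baseCoef I t k a b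
  else ∑ a' ∈ (I ⟨k + 1, h⟩).erase (⟨k + 1, by omega⟩ : Fin N), baseCoef I t k a a' * C a' b

/-- The reduced echelon matrices with given free entries. -/
noncomputable def coef (k : Fin (N / 2)) : Fin N → Fin N → R :=
  if h : (k : ℕ) + 1 < N / 2 then stepCoef I t k h (coef ⟨k + 1, h⟩) else topCoef I t k
termination_by N / 2 - (k : ℕ)

variable {I t}

lemma baseCoef_of_free {k : Fin (N / 2)} {a b : Fin N} (h : IsFree I k a b) :
    baseCoef I t k a b = t k a b := by
  rw [baseCoef, if_neg h.2.1, if_pos h]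

lemma baseCoef_of_mem {k : Fin (N / 2)} {a b : Fin N} (h : b ∈ I k) :
    baseCoef I t k a b = if a = b then 1 else 0 := by
  rw [baseCoef, if_pos h]

lemma baseCoef_upper {k : Fin (N / 2)} {a b : Fin N} (h : rowLabel N k a < rowLabel N k b) :
    baseCoef I t k a b = 0 := by
  rw [baseCoef]
  split_ifs with h1 h2 h3
  · subst h2
    exact absurd h (lt_irrefl _)
  · rfl
  · exact absurd h3.2.2.1 (by omega)
  · rfl

lemma coef_of_free {k : Fin (N / 2)} {a b : Fin N} (h : IsFree I k a b) :
    coef I t k a b = t k a b := by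
  rw [coef]
  split_ifs with hk
  · rw [stepCoef, if_pos (h.2.2.2.1 hk), baseCoef_of_free h]
  · rw [topCoef, if_pos, baseCoef_of_free h]
    have := h.2.2.2.2 (by omega)
    tauto

/-- The labels of `s` and its dual add up to `2 * N + 1`. If both factors were within their leads,
the labels of `a` and `a'` would add up to at least that, against `h`. This is why the entries
solved from isotropy still vanish beyond the lead. -/
lemma unpaired_base_mul_eq_zero {k : Fin (N / 2)} (hk : (k : ℕ) + 1 = N / 2) {a a' s : Fin N}
    (ha' : a' ≠ Fin.rev a') (hs : s ∈ unpaired (I k))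
    (h : rowLabel N k a < rowLabel N k (Fin.rev a')) :
    baseCoef I t k a s * baseCoef I t k a' (Fin.rev s) = 0 := by
  have h1 := rowLabel_rev hk (Finset.mem_filter.mp hs).2.2.2
  have h2 := rowLabel_rev hk ha'
  by_cases h3 : rowLabel N k a < rowLabel N k s
  · rw [baseCoef_upper h3, zero_mul]
  · rw [baseCoef_upper (a := a') (by omega), mul_zero]

lemma topCoef_isReduced {k : Fin (N / 2)} (hk : (k : ℕ) + 1 = N / 2) :
    IsReduced (rowLabel N k) (I k) (topCoef I t k) where
  delta a _ b hb := by rw [topCoef, if_pos (Or.inl hb), baseCoef_of_mem hb]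
  upper a ha b hab := by
    rw [topCoef]
    split_ifs with h1 h2
    · exact baseCoef_upper hab
    · subst h2
      push Not at h1
      have hb : Fin.rev b ≠ b := by
        rintro h
        exact h1.1 (h ▸ ha)
      rw [Finset.sum_eq_zero, mul_zero, neg_zero]
      intro s hs
      exact unpaired_base_mul_eq_zero hk (by simpa using hb) hs (by simpa using hab)
    · push Not at h1
      have hb : Fin.rev b ≠ b := by
        rintro h
        exact h1.1 (h ▸ h1.2.1)
      rw [Finset.sum_eq_zero, add_zero, neg_eq_zero]
      · by_cases hra : a = Fin.rev a
        · rw [baseCoef_of_mem (hra ▸ ha), ← hra, if_neg h2]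
        · have e1 := rowLabel_rev hk hra
          have e2 := rowLabel_rev hk hb.symm
          exact baseCoef_upper (by omega)
      · intro s hs
        exact unpaired_base_mul_eq_zero hk (by simpa using hb) hs (by simpa using hab)

lemma topCoef_unpaired {k : Fin (N / 2)} {a s : Fin N} (hs : s ∈ unpaired (I k)) :
    topCoef I t k a s = baseCoef I t k a s ∧
      topCoef I t k a (Fin.rev s) = baseCoef I t k a (Fin.rev s) := by
  obtain ⟨-, h1, h2, -⟩ := Finset.mem_filter.mp hs
  exact ⟨by rw [topCoef, if_pos (Or.inr (Or.inl h2))],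
    by rw [topCoef, if_pos (Or.inr (Or.inl (by simpa using h1)))]⟩

lemma topCoef_rev_add {k : Fin (N / 2)}
    (hI : ∀ a ∈ I k, a ≠ Fin.rev a → Fin.rev a ∉ I k) {a a' : Fin N} (ha : a ∈ I k)
    (ha' : a' ∈ I k) (hra : a ≠ Fin.rev a) (hra' : a' ≠ Fin.rev a')
    (h : rowLabel N k a < rowLabel N k a') :
    topCoef I t k a' (Fin.rev a) + topCoef I t k a (Fin.rev a') +
      ∑ s ∈ unpaired (I k), topCoef I t k a s * topCoef I t k a' (Fin.rev s) = 0 := by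
  rw [Finset.sum_congr rfl fun s hs => by
    rw [(topCoef_unpaired (a := a) hs).1, (topCoef_unpaired (a := a') hs).2]]
  have hne : a' ≠ a := by rintro rfl; exact lt_irrefl _ h
  rw [topCoef, if_pos (Or.inr (Or.inr (by simpa using h))), topCoef, if_neg, Fin.rev_rev,
    if_neg hne]
  · ring
  · simp only [Fin.rev_rev, not_or, not_not]
    exact ⟨hI a' ha' hra', ha', by omega⟩

lemma topCoef_iso {k : Fin (N / 2)} (hk : (k : ℕ) + 1 = N / 2)
    (hI : ∀ a ∈ I k, a ≠ Fin.rev a → Fin.rev a ∉ I k) {a a' : Fin N} (ha : a ∈ I k)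
    (ha' : a' ∈ I k) : middleForm (topCoef I t k a) (topCoef I t k a') = 0 := by
  have hred := topCoef_isReduced (I := I) (t := t) hk
  by_cases hra : a = Fin.rev a
  · exact middleForm_selfdual_left hk hred ha hra _
  by_cases hra' : a' = Fin.rev a'
  · exact middleForm_selfdual_right hk hred ha' hra' _
  rw [middleForm_reduced hI hred.delta ha ha' hra hra']
  rcases lt_trichotomy (rowLabel N k a) (rowLabel N k a') with h | h | h
  · exact topCoef_rev_add hI ha ha' hra hra' h
  · obtain rfl := rowLabel_injective k h
    rw [Finset.sum_congr rfl fun s hs => by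
      rw [(topCoef_unpaired (a := a) hs).1, (topCoef_unpaired (a := a) hs).2]]
    rw [topCoef, if_neg, Fin.rev_rev, if_pos rfl]
    · have h2 : algebraMap ℂ R (1 / 2) + algebraMap ℂ R (1 / 2) = 1 := by
        rw [← map_add]; norm_num
      linear_combination (- ∑ s ∈ unpaired (I k),
        baseCoef I t k a s * baseCoef I t k a (Fin.rev s)) * h2
    · simp only [Fin.rev_rev, not_or, not_not]
      exact ⟨hI a ha hra, ha, lt_irrefl _⟩
  -- By symmetry of the form this is the first case with the roles exchanged; replacing `s` by its
  -- dual matches the two sums.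
  · rw [← topCoef_rev_add (t := t) hI ha' ha hra' hra h]
    congr 1
    · ring
    · refine Finset.sum_nbij' Fin.rev Fin.rev ?_ ?_ ?_ ?_ ?_
      · intro s hs
        simpa [unpaired, and_left_comm, eq_comm] using hs
      · intro s hs
        simpa [unpaired, and_left_comm, eq_comm] using hs
      · simp
      · simp
      · intro s _
        rw [Fin.rev_rev, mul_comm]

/-- In each term either `a'` ranks above `a` and its coefficient vanishes, or `b` ranks above `a'`.
The second comparison carries over to the next order because neither position is the one that moves.
-/
lemma stepCoef_isReduced {k : Fin (N / 2)} (h : (k : ℕ) + 1 < N / 2)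
    (hI : I k ⊆ insert (⟨k + 1, by omega⟩ : Fin N) (I ⟨k + 1, h⟩)) {C : Fin N → Fin N → R}
    (hC : IsReduced (rowLabel N ⟨k + 1, h⟩) (I ⟨k + 1, h⟩) C) :
    IsReduced (rowLabel N k) (I k) (stepCoef I t k h C) where
  delta a _ b hb := by rw [stepCoef, if_pos (hI hb), baseCoef_of_mem hb]
  upper a ha b hab := by
    rw [stepCoef]
    split_ifs with hb
    · exact baseCoef_upper hab
    · rw [Finset.mem_insert, not_or] at hb
      refine Finset.sum_eq_zero fun a' ha' => ?_
      obtain ⟨h1, h2⟩ := Finset.mem_erase.mp ha'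
      have e1 := rowLabel_succ h (a := b) fun e => hb.1 (Fin.ext e)
      have e2 := rowLabel_succ h (a := a') fun e => h1 (Fin.ext e)
      rcases lt_or_ge (rowLabel N k a) (rowLabel N k a') with hlt | hge
      · rw [baseCoef_upper hlt, zero_mul]
      · rw [hC.upper a' h2 b (by rw [e1, e2]; exact lt_of_le_of_lt hge hab), mul_zero]

/-- In the leading columns of the next matrix the equation is a tautology, as that matrix is
reduced; in the other columns it is the definition. -/
lemma stepCoef_incid {k : Fin (N / 2)} (h : (k : ℕ) + 1 < N / 2) {C : Fin N → Fin N → R}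
    (hC : IsReduced (rowLabel N ⟨k + 1, h⟩) (I ⟨k + 1, h⟩) C) (a : Fin N) {b : Fin N}
    (hb : (b : ℕ) ≠ k + 1) :
    stepCoef I t k h C a b = ∑ a' ∈ (I ⟨k + 1, h⟩).erase (⟨k + 1, by omega⟩ : Fin N),
      stepCoef I t k h C a a' * C a' b := by
  have hb' : b ≠ ⟨k + 1, by omega⟩ := fun e => hb (congrArg Fin.val e)
  have hbase : ∀ a' ∈ (I ⟨k + 1, h⟩).erase (⟨k + 1, by omega⟩ : Fin N),
      stepCoef I t k h C a a' = baseCoef I t k a a' := fun a' ha' => by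
    rw [stepCoef, if_pos (Finset.mem_insert_of_mem (Finset.mem_erase.mp ha').2)]
  by_cases hbI : b ∈ I ⟨k + 1, h⟩
  · rw [Finset.sum_eq_single b]
    · rw [hC.self hbI, mul_one]
    · intro a' ha' hab
      rw [hC.delta a' (Finset.mem_erase.mp ha').2 b hbI, if_neg hab, mul_zero]
    · exact fun hn => absurd (Finset.mem_erase.mpr ⟨hb', hbI⟩) hn
  · rw [Finset.sum_congr rfl fun a' ha' => by rw [hbase a' ha'], stepCoef, if_neg]
    rw [Finset.mem_insert, not_or]
    exact ⟨hb', hbI⟩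

lemma coef_step {k : Fin (N / 2)} (h : (k : ℕ) + 1 < N / 2) :
    coef I t k = stepCoef I t k h (coef I t ⟨k + 1, h⟩) := by
  rw [coef, dif_pos h]

lemma coef_top {k : Fin (N / 2)} (h : (k : ℕ) + 1 = N / 2) : coef I t k = topCoef I t k := by
  rw [coef, dif_neg (by omega)]

lemma coef_isReduced (hI : I ∈ indexSet N) (m : ℕ) :
    ∀ k : Fin (N / 2), N / 2 = k + 1 + m →
      IsReduced (rowLabel N k) (I k) (coef I t k) := by
  induction m with
  | zero =>
    intro k hk
    rw [coef_top hk.symm]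
    exact topCoef_isReduced hk.symm
  | succ m ih =>
    intro k hk
    have h : (k : ℕ) + 1 < N / 2 := by omega
    rw [coef_step h]
    exact stepCoef_isReduced h (hI.2.1 k h) (ih ⟨k + 1, h⟩ (by simp only; omega))

/-- The reduced echelon matrices with arbitrary free entries exist. -/
lemma coef_isValid (hI : I ∈ indexSet N) : IsValid I (coef I t) where
  red k := coef_isReduced hI (N / 2 - (k + 1)) k (by omega)
  incid k h a _ b hb := by
    rw [coef_step (k := ⟨k, by omega⟩) h]
    exact stepCoef_incid (k := ⟨k, by omega⟩) h
      (coef_isReduced hI (N / 2 - (k + 2)) ⟨k + 1, h⟩ (by simp only; omega)) a hb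
  iso k hk a ha a' ha' := by
    rw [coef_top hk]
    exact topCoef_iso hk (hI.2.2 k hk) ha ha'

end Construction

/-! ### The free entries determine the echelon matrices. -/

section Uniqueness

variable [Algebra ℂ R] {I : Fin (N / 2) → Finset (Fin N)} {C C' : Fin (N / 2) → Fin N → Fin N → R}

lemma IsReduced.eq_of_not_lt {ι : Type*} [DecidableEq ι] {r : ι → ℕ}
    (hr : Function.Injective r) {S : Finset ι} {v v' : ι → ι → R}
    (hv : IsReduced r S v) (hv' : IsReduced r S v') {a b : ι} (ha : a ∈ S)
    (h : b ∈ S ∨ ¬ r b < r a) : v a b = v' a b := by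
  by_cases hb : b ∈ S
  · rw [hv.delta a ha b hb, hv'.delta a ha b hb]
  · have hne : r a ≠ r b := fun e => hb (hr e ▸ ha)
    have hlt : r a < r b := by
      rcases h with h | h
      · exact absurd h hb
      · omega
    rw [hv.upper a ha b hlt, hv'.upper a ha b hlt]

lemma IsValid.eq_top (hI : I ∈ indexSet N) (hC : IsValid I C) (hC' : IsValid I C')
    (hfree : ∀ k a b, IsFree I k a b → C k a b = C' k a b) {k : Fin (N / 2)}
    (hk : (k : ℕ) + 1 = N / 2) {a : Fin N} (ha : a ∈ I k) (b : Fin N) : C k a b = C' k a b := by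
  have hr := rowLabel_injective k
  have hbase : ∀ a ∈ I k, ∀ b, (Fin.rev b ∈ I k → rowLabel N k (Fin.rev b) < rowLabel N k a) →
      C k a b = C' k a b := by
    intro a ha b h
    by_cases hb : b ∈ I k ∨ ¬ rowLabel N k b < rowLabel N k a
    · exact (hC.red k).eq_of_not_lt hr (hC'.red k) ha hb
    · push Not at hb
      exact hfree k a b ⟨ha, hb.1, hb.2, fun h => by omega, fun _ => h⟩
  by_cases h1 : Fin.rev b ∈ I k → rowLabel N k (Fin.rev b) < rowLabel N k a
  · exact hbase a ha b h1
  push Not at h1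
  by_cases hbI : b ∈ I k
  · exact (hC.red k).eq_of_not_lt hr (hC'.red k) ha (Or.inl hbI)
  by_cases hra : a = Fin.rev a
  · refine (hC.red k).eq_of_not_lt hr (hC'.red k) ha (Or.inr ?_)
    have := rowLabel_lt_of_selfdual hk hra (b := b) (by rintro rfl; exact hbI ha)
    omega
  -- What remains is the dual of a leading position `a'` not ranking below `a`; isotropy of the
  -- vectors of `a` and `a'` decides this entry.
  obtain ⟨a', rfl⟩ : ∃ a', b = Fin.rev a' := ⟨Fin.rev b, by simp⟩
  rw [Fin.rev_rev] at h1
  obtain ⟨ha', hle⟩ := h1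
  have hra' : a' ≠ Fin.rev a' := fun e => hbI (e ▸ ha')
  have hsum : ∑ s ∈ unpaired (I k), C k a s * C k a' (Fin.rev s) =
      ∑ s ∈ unpaired (I k), C' k a s * C' k a' (Fin.rev s) := by
    refine Finset.sum_congr rfl fun s hs => ?_
    obtain ⟨-, h1, h2, -⟩ := Finset.mem_filter.mp hs
    rw [hbase a ha s fun h => absurd h h2,
      hbase a' ha' (Fin.rev s) fun h => absurd h (by simpa using h1)]
  have e := hC.iso k hk a ha a' ha'
  have e' := hC'.iso k hk a ha a' ha'
  rw [middleForm_reduced (hI.2.2 k hk) (hC.red k).delta ha ha' hra hra'] at e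
  rw [middleForm_reduced (hI.2.2 k hk) (hC'.red k).delta ha ha' hra hra',
    ← hsum] at e'
  rcases hle.eq_or_lt with heq | hlt
  -- The unknown entry occurs twice in the equation, so one divides by two.
  · obtain rfl := hr heq
    have h2 : algebraMap ℂ R (1 / 2) + algebraMap ℂ R (1 / 2) = 1 := by
      rw [← map_add]; norm_num
    linear_combination algebraMap ℂ R (1 / 2) * (e - e') -
      (C k a (Fin.rev a) - C' k a (Fin.rev a)) * h2
  -- The companion entry, of `a'` at the dual of `a`, is free or trivially determined because `a`
  -- ranks below `a'`.
  · have := hbase a' ha' (Fin.rev a) fun _ => by simpa using hlt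
    linear_combination e - e' - this

/-- The reduced echelon matrices are determined by their free entries. -/
lemma IsValid.eq_of_free (hI : I ∈ indexSet N) (hC : IsValid I C) (hC' : IsValid I C')
    (hfree : ∀ k a b, IsFree I k a b → C k a b = C' k a b) (m : ℕ) :
    ∀ k : Fin (N / 2), N / 2 = k + 1 + m → ∀ a ∈ I k, ∀ b, C k a b = C' k a b := by
  induction m with
  | zero => exact fun k hk a ha b => hC.eq_top hI hC' hfree hk.symm ha b
  | succ m ih =>
    intro k hk a ha b
    have h : (k : ℕ) + 1 < N / 2 := by omega
    have hr := rowLabel_injective k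
    have hbase : ∀ b ∈ insert (⟨k + 1, by omega⟩ : Fin N) (I ⟨k + 1, h⟩), C k a b = C' k a b := by
      intro b hb
      by_cases hb' : b ∈ I k ∨ ¬ rowLabel N k b < rowLabel N k a
      · exact (hC.red k).eq_of_not_lt hr (hC'.red k) ha hb'
      · push Not at hb'
        exact hfree k a b ⟨ha, hb'.1, hb'.2, fun _ => hb, fun h => by omega⟩
    by_cases hb : b ∈ insert (⟨k + 1, by omega⟩ : Fin N) (I ⟨k + 1, h⟩)
    · exact hbase b hb
    have hb1 : (b : ℕ) ≠ k + 1 := fun e => hb (Finset.mem_insert.mpr (Or.inl (Fin.ext e)))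
    rw [hC.incid k h a ha b hb1, hC'.incid k h a ha b hb1]
    refine Finset.sum_congr rfl fun a' ha' => ?_
    have ha'' := (Finset.mem_erase.mp ha').2
    rw [ih ⟨k + 1, h⟩ (by simp only; omega) a' ha'' b]
    congr 1
    exact hbase a' (Finset.mem_insert_of_mem ha'')

end Uniqueness

end DegFlag

/-! ### Points of a cell as solutions of the equations. -/

namespace DegFlag

variable {N : ℕ}

/-- The reduced echelon bases of the members of a collection of subspaces. -/
noncomputable def redCoef (V : Coll N) (k : Fin (N / 2)) : Fin N → Fin N → ℂ :=
  reduced (rowLabel_injective k) (V k)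

/-- The collection of subspaces spanned by the vectors with indices in a collection of sets. -/
def spanColl (I : Fin (N / 2) → Finset (Fin N)) (C : Fin (N / 2) → Fin N → Fin N → ℂ) : Coll N :=
  fun k => Submodule.span ℂ (C k '' I k)

section Cells

variable {I : Fin (N / 2) → Finset (Fin N)} {V : Coll N} {C : Fin (N / 2) → Fin N → Fin N → ℂ}

lemma redCoef_mem (hV : V ∈ cell N I) {k : Fin (N / 2)} {a : Fin N} (ha : a ∈ I k) :
    redCoef V k a ∈ V k :=
  reduced_mem _ _ (by rwa [(mem_cell_iff.mp hV).2 k])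

lemma redCoef_isReduced (hV : V ∈ cell N I) (k : Fin (N / 2)) :
    IsReduced (rowLabel N k) (I k) (redCoef V k) := by
  have := reduced_isReduced (rowLabel_injective k) (V k)
  rwa [(mem_cell_iff.mp hV).2 k] at this

lemma eq_sum_redCoef (hV : V ∈ cell N I) {k : Fin (N / 2)} {w : Fin N → ℂ} (hw : w ∈ V k) :
    w = ∑ a ∈ I k, w a • redCoef V k a := by
  have := eq_sum_reduced (rowLabel_injective k) hw
  rwa [(mem_cell_iff.mp hV).2 k] at this

lemma eq_of_cell (hV : V ∈ cell N I) {k : Fin (N / 2)} {w w' : Fin N → ℂ} (hw : w ∈ V k)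
    (hw' : w' ∈ V k) (h : ∀ a ∈ I k, w a = w' a) : w = w' := by
  rw [← (mem_cell_iff.mp hV).2 k] at h
  exact eq_of_leadSet hw hw' h

lemma spanColl_redCoef (hV : V ∈ cell N I) : spanColl I (redCoef V) = V := by
  funext k
  have := span_reduced (rowLabel_injective k) (V k)
  rwa [(mem_cell_iff.mp hV).2 k] at this

/-- The projected vector is expanded in the reduced basis of the next space: the coefficients are
its coordinates in the leading positions. The coordinate killed by the projection contributes
nothing, hence the `erase`. -/
lemma redCoef_isValid (hV : V ∈ cell N I) : IsValid I (redCoef V) where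
  red := redCoef_isReduced hV
  incid k h a ha b hb := by
    obtain ⟨-, hinc, -⟩ := mem_SOF_iff.mp hV.1
    have hw := congrFun (eq_sum_redCoef hV (hinc k h _ (redCoef_mem hV ha))) b
    rw [Finset.sum_apply] at hw
    have hb' : b ≠ ⟨k + 1, by omega⟩ := fun e => hb (congrArg Fin.val e)
    simp only [pr, LinearMap.coe_mk, AddHom.coe_mk, if_neg hb', Pi.smul_apply, smul_eq_mul,
      ite_mul, zero_mul] at hw
    rw [hw]
    symm
    rw [← Finset.filter_ne', Finset.sum_filter]
    exact Finset.sum_congr rfl fun a' _ => by split_ifs <;> simp_all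
  iso k hk a ha a' ha' :=
    (mem_SOF_iff.mp hV.1).2.2 k hk _ (redCoef_mem hV ha) _ (redCoef_mem hV ha')

lemma IsValid.spanColl_mem_cell (hI : ∀ k, (I k).card = (k : ℕ) + 1) (hC : IsValid I C) :
    spanColl I C ∈ cell N I := by
  refine mem_cell_iff.mpr ⟨mem_SOF_iff.mpr ⟨fun k => ?_, ?_, ?_⟩,
    fun k => (hC.red k).leadSet_span (rowLabel_injective k)⟩
  · rw [spanColl, (hC.red k).finrank_span (rowLabel_injective k), hI]
  · intro k h x hx
    suffices spanColl I C ⟨k, by omega⟩ ≤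
        (spanColl I C ⟨k + 1, h⟩).comap (pr N ⟨k + 1, by omega⟩) from this hx
    rw [spanColl, Submodule.span_le]
    rintro _ ⟨a, ha, rfl⟩
    have : pr N ⟨k + 1, by omega⟩ (C ⟨k, by omega⟩ a) =
        ∑ a' ∈ (I ⟨k + 1, h⟩).erase (⟨k + 1, by omega⟩ : Fin N),
          C ⟨k, by omega⟩ a a' • C ⟨k + 1, h⟩ a' := by
      ext b
      simp only [pr, LinearMap.coe_mk, AddHom.coe_mk, Finset.sum_apply, Pi.smul_apply, smul_eq_mul]
      split_ifs with hb
      -- The incidence equations omit the killed coordinate; there both sides vanish, since this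
      -- position is the highest one in the next order.
      · symm
        refine Finset.sum_eq_zero fun a' ha' => ?_
        obtain ⟨h1, h2⟩ := Finset.mem_erase.mp ha'
        have h1' : (a' : ℕ) ≠ k + 1 := fun e => h1 (Fin.ext e)
        by_cases hbI : b ∈ I ⟨k + 1, h⟩
        · rw [(hC.red _).delta a' h2 b hbI, if_neg (hb ▸ h1), mul_zero]
        · rw [(hC.red _).upper a' h2 b, mul_zero]
          subst hb
          simp only [rowLabel]
          have := a'.2
          split_ifs <;> omega
      · exact hC.incid k h a ha b fun e => hb (Fin.ext e)
    rw [SetLike.mem_coe, Submodule.mem_comap, this]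
    exact Submodule.sum_mem _ fun a' ha' => Submodule.smul_mem _ _
      (Submodule.subset_span ⟨a', (Finset.mem_erase.mp ha').2, rfl⟩)
  · intro k hk x hx y hy
    induction hx, hy using Submodule.span_induction₂ with
    | mem_mem x y hx hy =>
      obtain ⟨a, ha, rfl⟩ := hx
      obtain ⟨a', ha', rfl⟩ := hy
      exact hC.iso k hk a ha a' ha'
    | zero_left => simp [middleForm]
    | zero_right => simp [middleForm]
    | add_left x y z _ _ _ h1 h2 =>
      simp only [middleForm, Pi.add_apply, add_mul, Finset.sum_add_distrib] at *
      rw [h1, h2, add_zero]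
    | add_right x y z _ _ _ h1 h2 =>
      simp only [middleForm, Pi.add_apply, mul_add, Finset.sum_add_distrib] at *
      rw [h1, h2, add_zero]
    | smul_left c x y _ _ h =>
      simp only [middleForm, Pi.smul_apply, smul_eq_mul, mul_assoc, ← Finset.mul_sum] at *
      rw [h, mul_zero]
    | smul_right c x y _ _ h =>
      simp only [middleForm, Pi.smul_apply, smul_eq_mul, mul_left_comm _ c,
        ← Finset.mul_sum] at *
      rw [h, mul_zero]

lemma IsValid.redCoef_spanColl (hC : IsValid I C) {k : Fin (N / 2)} {a : Fin N} (ha : a ∈ I k) :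
    redCoef (spanColl I C) k a = C k a :=
  (hC.red k).reduced_span (rowLabel_injective k) ha

end Cells

/-! ### Cramer's rule: regularity of the coordinates and local closedness. -/

section Minors

variable {I : Fin (N / 2) → Finset (Fin N)} (e : ∀ k : Fin (N / 2), Fin ((k : ℕ) + 1) ≃ I k)
  {R S : Type*} [CommRing R] [CommRing S]

/-- The square submatrix with rows in `I k` of the matrix with index `k`. -/
def minorMatrix (M : FrameIndex N → R) (k : Fin (N / 2)) :
    Matrix (Fin ((k : ℕ) + 1)) (Fin ((k : ℕ) + 1)) R :=
  Matrix.of fun i j => M ⟨k, (e k i, j)⟩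

/-- The numerators of the entries of the reduced echelon matrices, as functions of a frame; the
denominators are the minors with rows in `I k`. -/
noncomputable def numer (M : FrameIndex N → R) (k : Fin (N / 2)) (a b : Fin N) : R :=
  if ha : a ∈ I k then
    ∑ j, M ⟨k, (b, j)⟩ * (minorMatrix e M k).adjugate j ((e k).symm ⟨a, ha⟩)
  else 0

lemma map_minor (f : R →+* S) (M : FrameIndex N → R) (k : Fin (N / 2)) :
    f (minorMatrix e M k).det = (minorMatrix e (fun s => f (M s)) k).det := by
  rw [RingHom.map_det]
  rfl

lemma map_numer (f : R →+* S) (M : FrameIndex N → R) (k : Fin (N / 2)) (a b : Fin N) :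
    f (numer e M k a b) = numer e (fun s => f (M s)) k a b := by
  have hmap : f.mapMatrix (minorMatrix e M k) = minorMatrix e (fun s => f (M s)) k := rfl
  rw [numer, numer]
  split_ifs with ha
  · rw [map_sum, ← hmap, ← RingHom.map_adjugate]
    simp
  · simp

lemma eval_minor (M : FrameIndex N → ℂ) (k : Fin (N / 2)) :
    MvPolynomial.eval M (minorMatrix e (fun s => MvPolynomial.X (R := ℂ) s) k).det =
      (minorMatrix e M k).det := by
  rw [map_minor]
  simp

lemma eval_numer (M : FrameIndex N → ℂ) (k : Fin (N / 2)) (a b : Fin N) :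
    MvPolynomial.eval M (numer e (fun s => MvPolynomial.X (R := ℂ) s) k a b) =
      numer e M k a b := by
  rw [map_numer]
  simp

/-- This is the identity `A * adj A = det A • 1` for the submatrix `A` with rows in `I k`. -/
lemma numer_delta (M : FrameIndex N → R) {k : Fin (N / 2)} {a b : Fin N} (ha : a ∈ I k)
    (hb : b ∈ I k) : numer e M k a b = if a = b then (minorMatrix e M k).det else 0 := by
  have := congrFun₂ (Matrix.mul_adjugate (minorMatrix e M k)) ((e k).symm ⟨b, hb⟩)
    ((e k).symm ⟨a, ha⟩)
  rw [Matrix.mul_apply] at this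
  simp only [Matrix.smul_apply, Matrix.one_apply, EmbeddingLike.apply_eq_iff_eq, Subtype.mk.injEq,
    smul_eq_mul, mul_ite, mul_one, mul_zero, minorMatrix, Matrix.of_apply,
    Equiv.apply_symm_apply] at this
  rw [numer, dif_pos ha]
  simp only [minorMatrix, this, eq_comm]

variable {e} {M : FrameIndex N → ℂ} {V : Coll N}

lemma IsFrameOf.finrank (hM : IsFrameOf N M V) (k : Fin (N / 2)) :
    Module.finrank ℂ (V k) = (k : ℕ) + 1 := by
  rw [← (hM k).2, finrank_span_eq_card (hM k).1, Fintype.card_fin]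

lemma IsFrameOf.numer_mem (hM : IsFrameOf N M V) (k : Fin (N / 2)) (a : Fin N) :
    numer e M k a ∈ V k := by
  by_cases ha : a ∈ I k
  · have : numer e M k a = ∑ j, (minorMatrix e M k).adjugate j ((e k).symm ⟨a, ha⟩) •
        frameVec N M k j := by
      ext b
      simp [numer, ha, frameVec, Finset.sum_apply, mul_comm]
    rw [this, ← (hM k).2]
    exact Submodule.sum_mem _ fun j _ => Submodule.smul_mem _ _
      (Submodule.subset_span (Set.mem_range_self j))
  · have : numer e M k a = 0 := by
      ext b
      simp [numer, ha]
    rw [this]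
    exact Submodule.zero_mem _

/-- The vanishing of the minor is thereby expressed through `V` alone, independently of the frame.
-/
lemma IsFrameOf.minor_eq_zero_iff (hM : IsFrameOf N M V) (k : Fin (N / 2)) :
    (minorMatrix e M k).det = 0 ↔ ∃ w ∈ V k, w ≠ 0 ∧ ∀ a ∈ I k, w a = 0 := by
  have happ : ∀ (x : Fin ((k : ℕ) + 1) → ℂ) i,
      (∑ j, x j • frameVec N M k j) (e k i) = Matrix.mulVec (minorMatrix e M k) x i := by
    intro x i
    simp [Matrix.mulVec, dotProduct, minorMatrix, frameVec, Finset.sum_apply, mul_comm]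
  rw [← Matrix.exists_mulVec_eq_zero_iff]
  constructor
  · rintro ⟨x, hx, h0⟩
    refine ⟨∑ j, x j • frameVec N M k j, ?_, ?_, ?_⟩
    · rw [← (hM k).2]
      exact Submodule.sum_mem _ fun j _ => Submodule.smul_mem _ _
        (Submodule.subset_span (Set.mem_range_self j))
    · exact fun h => hx (funext (Fintype.linearIndependent_iff.mp (hM k).1 x h))
    · intro a ha
      have := happ x ((e k).symm ⟨a, ha⟩)
      rwa [Equiv.apply_symm_apply, h0] at this
  · rintro ⟨w, hw, hne, h0⟩
    rw [← (hM k).2] at hw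
    obtain ⟨x, rfl⟩ := (Submodule.mem_span_range_iff_exists_fun ℂ).mp hw
    refine ⟨x, ?_, ?_⟩
    · rintro rfl
      simp at hne
    · ext i
      rw [← happ, h0 _ (e k i).2, Pi.zero_apply]

lemma IsFrameOf.minor_ne_zero (hM : IsFrameOf N M V) (hV : V ∈ cell N I) (k : Fin (N / 2)) :
    (minorMatrix e M k).det ≠ 0 := by
  rw [Ne, hM.minor_eq_zero_iff]
  rintro ⟨w, hw, hne, h0⟩
  exact hne (eq_of_cell hV hw (Submodule.zero_mem _) h0)

/-- Both sides are vectors of `V k` that agree in the leading positions. -/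
lemma IsFrameOf.numer_eq (hM : IsFrameOf N M V) (hV : V ∈ cell N I) {k : Fin (N / 2)} {a : Fin N}
    (ha : a ∈ I k) (b : Fin N) :
    numer e M k a b = (minorMatrix e M k).det * redCoef V k a b := by
  have := eq_of_cell hV (hM.numer_mem (e := e) k a)
    ((V k).smul_mem (minorMatrix e M k).det (redCoef_mem hV ha)) fun b hb => by
      rw [numer_delta e M ha hb, Pi.smul_apply, (redCoef_isReduced hV k).delta a ha b hb]
      simp
  exact congrFun this b

variable (I) in
/-- The entries of the reduced echelon matrices are regular functions on the cell. -/
lemma isRegularFunction_redCoef (hI : ∀ k, (I k).card = (k : ℕ) + 1) {k : Fin (N / 2)} {a : Fin N}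
    (ha : a ∈ I k) (b : Fin N) :
    IsRegularFunction N (cell N I) (fun V => redCoef (V : Coll N) k a b) := by
  have e : ∀ k : Fin (N / 2), Fin ((k : ℕ) + 1) ≃ I k := fun k =>
    ((I k).equivFinOfCardEq (hI k)).symm
  intro V₀ M₀ hM₀
  refine ⟨numer e MvPolynomial.X k a b, (minorMatrix e MvPolynomial.X k).det, ?_, ?_⟩
  · rw [eval_minor]
    exact hM₀.minor_ne_zero V₀.2 k
  · intro V M hM hne
    rw [eval_minor] at hne
    rw [eval_numer, eval_minor, hM.numer_eq V.2 ha, mul_div_cancel_left₀ _ hne]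

/-- The complement of the chart of the product of Grassmannians given by `I`. -/
def chartCompl (I : Fin (N / 2) → Finset (Fin N)) : Set (Coll N) :=
  {V | (∀ k, Module.finrank ℂ (V k) = (k : ℕ) + 1) ∧
    ∃ k, ∃ w ∈ V k, w ≠ 0 ∧ ∀ a ∈ I k, w a = 0}

variable (e) in
/-- The product of the minors that define the chart given by `I`. -/
noncomputable def chartPoly : MvPolynomial (FrameIndex N) ℂ :=
  ∏ k, (minorMatrix e MvPolynomial.X k).det

lemma IsFrameOf.eval_chartPoly_eq_zero_iff (hM : IsFrameOf N M V) :
    MvPolynomial.eval M (chartPoly e) = 0 ↔ V ∈ chartCompl I := by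
  simp only [chartPoly, map_prod, eval_minor, Finset.prod_eq_zero_iff, Finset.mem_univ, true_and,
    hM.minor_eq_zero_iff, chartCompl, Set.mem_ofPred_eq]
  exact ⟨fun h => ⟨hM.finrank, h⟩, fun h => h.2⟩

lemma isZariskiClosed_chartCompl (hI : ∀ k, (I k).card = (k : ℕ) + 1) :
    IsZariskiClosed N (chartCompl I) := by
  have e : ∀ k : Fin (N / 2), Fin ((k : ℕ) + 1) ≃ I k := fun k =>
    ((I k).equivFinOfCardEq (hI k)).symm
  refine ⟨fun V hV => hV.1, {chartPoly e}, fun V M hM => ?_⟩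
  simp [hM.eval_chartPoly_eq_zero_iff]

/-- The hypotheses are the equations of the cell with denominators cleared. Dividing by the minors
gives a valid family inside `V`, which spans `V` by dimension. -/
lemma IsFrameOf.mem_cell (hI : ∀ k, (I k).card = (k : ℕ) + 1) (hM : IsFrameOf N M V)
    (hne : ∀ k, (minorMatrix e M k).det ≠ 0)
    (hup : ∀ k, ∀ a ∈ I k, ∀ b, rowLabel N k a < rowLabel N k b → numer e M k a b = 0)
    (hinc : ∀ (k : ℕ) (h : k + 1 < N / 2), ∀ a ∈ I ⟨k, by omega⟩, ∀ b : Fin N, (b : ℕ) ≠ k + 1 →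
      (minorMatrix e M ⟨k + 1, h⟩).det * numer e M ⟨k, by omega⟩ a b =
        ∑ a' ∈ (I ⟨k + 1, h⟩).erase (⟨k + 1, by omega⟩ : Fin N),
          numer e M ⟨k, by omega⟩ a a' * numer e M ⟨k + 1, h⟩ a' b)
    (hiso : ∀ k : Fin (N / 2), (k : ℕ) + 1 = N / 2 → ∀ a ∈ I k, ∀ a' ∈ I k,
      middleForm (numer e M k a) (numer e M k a') = 0) : V ∈ cell N I := by
  have hC : IsValid I (fun k a b => ((minorMatrix e M k).det)⁻¹ * numer e M k a b) := by
    refine ⟨fun k => ⟨fun a ha b hb => ?_, fun a ha b hb => ?_⟩, fun k h a ha b hb => ?_,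
      fun k hk a ha a' ha' => ?_⟩
    · rw [numer_delta e M ha hb]
      split_ifs
      · exact inv_mul_cancel₀ (hne k)
      · exact mul_zero _
    · rw [hup k a ha b hb, mul_zero]
    · have := hinc k h a ha b hb
      calc _ = ((minorMatrix e M ⟨k, by omega⟩).det)⁻¹ * (((minorMatrix e M ⟨k + 1, h⟩).det)⁻¹ *
            ((minorMatrix e M ⟨k + 1, h⟩).det * numer e M ⟨k, by omega⟩ a b)) := by
            rw [inv_mul_cancel_left₀ (hne _)]
        _ = _ := by
            rw [this, Finset.mul_sum, Finset.mul_sum]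
            exact Finset.sum_congr rfl fun _ _ => by ring
    · have := hiso k hk a ha a' ha'
      calc _ = (minorMatrix e M k).det⁻¹ * ((minorMatrix e M k).det⁻¹ *
            middleForm (numer e M k a) (numer e M k a')) := by
            rw [middleForm, middleForm, Finset.mul_sum, Finset.mul_sum]
            exact Finset.sum_congr rfl fun _ _ => by ring
        _ = 0 := by rw [this, mul_zero, mul_zero]
  have hV : spanColl I (fun k a b => ((minorMatrix e M k).det)⁻¹ * numer e M k a b) = V := by
    funext k
    apply Submodule.eq_of_le_of_finrank_eq
    · rw [spanColl, Submodule.span_le]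
      rintro _ ⟨a, -, rfl⟩
      exact (V k).smul_mem _ (hM.numer_mem k a)
    · rw [spanColl, (hC.red k).finrank_span (rowLabel_injective k), hI, hM.finrank]
  rw [← hV]
  exact hC.spanColl_mem_cell hI

/-- The equations taken are all polynomials that vanish on every frame of every point of the union.
Where the minors are nonzero, a polynomial vanishing on the cell can be tested after multiplication
by `chartPoly`, which vanishes off the chart. -/
lemma isZariskiClosed_cell_union (hI : ∀ k, (I k).card = (k : ℕ) + 1) :
    IsZariskiClosed N (cell N I ∪ chartCompl I) := by
  have e : ∀ k : Fin (N / 2), Fin ((k : ℕ) + 1) ≃ I k := fun k =>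
    ((I k).equivFinOfCardEq (hI k)).symm
  refine ⟨?_, {p | ∀ V ∈ cell N I ∪ chartCompl I, ∀ M, IsFrameOf N M V →
    MvPolynomial.eval M p = 0}, fun V M hM => ⟨fun hV p hp => hp V hV M hM, fun hp => ?_⟩⟩
  · rintro V (hV | hV)
    · exact hV.1.1
    · exact hV.1
  by_cases hQ : MvPolynomial.eval M (chartPoly e) = 0
  · exact Or.inr (hM.eval_chartPoly_eq_zero_iff.mp hQ)
  have key : ∀ h : MvPolynomial (FrameIndex N) ℂ,
      (∀ V ∈ cell N I, ∀ M, IsFrameOf N M V → MvPolynomial.eval M h = 0) →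
      MvPolynomial.eval M h = 0 := by
    intro h hh
    have := hp (chartPoly e * h) fun V hV M hM => by
      rw [map_mul]
      rcases hV with hV | hV
      · rw [hh V hV M hM, mul_zero]
      · rw [hM.eval_chartPoly_eq_zero_iff.mpr hV, zero_mul]
    rw [map_mul] at this
    exact (mul_eq_zero.mp this).resolve_left hQ
  refine Or.inl (hM.mem_cell (e := e) hI (fun k hk => hQ ?_) ?_ ?_ ?_)
  · rw [chartPoly, map_prod]
    exact Finset.prod_eq_zero (Finset.mem_univ k) (by rw [eval_minor, hk])
  · intro k a ha b hb
    have := key (numer e MvPolynomial.X k a b) fun V hV M hM => by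
      rw [eval_numer, hM.numer_eq hV ha, (redCoef_isReduced hV k).upper a ha b hb, mul_zero]
    rwa [eval_numer] at this
  · intro k h a ha b hb
    have := key ((minorMatrix e MvPolynomial.X ⟨k + 1, h⟩).det *
        numer e MvPolynomial.X ⟨k, by omega⟩ a b -
        ∑ a' ∈ (I ⟨k + 1, h⟩).erase (⟨k + 1, by omega⟩ : Fin N),
          numer e MvPolynomial.X ⟨k, by omega⟩ a a' * numer e MvPolynomial.X ⟨k + 1, h⟩ a' b)
      fun V hV M hM => by
        simp only [map_sub, map_mul, map_sum, eval_numer, eval_minor]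
        rw [hM.numer_eq hV ha, (redCoef_isValid hV).incid k h a ha b hb, sub_eq_zero,
          Finset.mul_sum, Finset.mul_sum]
        refine Finset.sum_congr rfl fun a' ha' => ?_
        rw [hM.numer_eq hV ha, hM.numer_eq hV (Finset.mem_erase.mp ha').2]
        ring
    simp only [map_sub, map_mul, map_sum, eval_numer, eval_minor] at this
    exact sub_eq_zero.mp this
  · intro k hk a ha a' ha'
    have := key (middleForm (numer e MvPolynomial.X k a) (numer e MvPolynomial.X k a'))
      fun V hV M hM => by
        rw [middleForm_map]
        simp only [eval_numer, hM.numer_eq hV ha, hM.numer_eq hV ha']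
        have := (redCoef_isValid hV).iso k hk a ha a' ha'
        calc _ = (minorMatrix e M k).det * ((minorMatrix e M k).det *
              middleForm (redCoef V k a) (redCoef V k a')) := by
              rw [middleForm, middleForm, Finset.mul_sum, Finset.mul_sum]
              exact Finset.sum_congr rfl fun _ _ => by ring
          _ = 0 := by rw [this, mul_zero, mul_zero]
    rw [middleForm_map] at this
    simpa only [eval_numer] using this

lemma isZariskiLocallyClosed_cell (hI : ∀ k, (I k).card = (k : ℕ) + 1) :
    IsZariskiLocallyClosed N (cell N I) := by
  refine ⟨_, _, isZariskiClosed_cell_union hI, isZariskiClosed_chartCompl hI, ?_⟩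
  ext V
  simp only [Set.mem_sdiff, Set.mem_union]
  refine ⟨fun hV => ⟨Or.inl hV, ?_⟩, fun h => h.1.resolve_right h.2⟩
  rintro ⟨-, k, w, hw, hne, h0⟩
  exact hne (eq_of_cell hV hw (Submodule.zero_mem _) h0)

end Minors

/-! ### The isomorphism with an affine space. -/

section Parametrization

open Classical in
/-- The set of free positions. -/
noncomputable def freeSet (I : Fin (N / 2) → Finset (Fin N)) :
    Finset (Fin (N / 2) × Fin N × Fin N) :=
  Finset.univ.filter fun q => IsFree I q.1 q.2.1 q.2.2

lemma mem_freeSet {I : Fin (N / 2) → Finset (Fin N)} {q : Fin (N / 2) × Fin N × Fin N} :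
    q ∈ freeSet I ↔ IsFree I q.1 q.2.1 q.2.2 := by
  simp [freeSet]

variable {I : Fin (N / 2) → Finset (Fin N)}

open Classical in
/-- The reduced echelon matrices of the generic point of the cell. -/
noncomputable def genericCoef (I : Fin (N / 2) → Finset (Fin N)) :
    Fin (N / 2) → Fin N → Fin N → MvPolynomial (Fin (freeSet I).card) ℂ :=
  coef I fun k a b => if h : (k, a, b) ∈ freeSet I then
    MvPolynomial.X ((freeSet I).equivFin ⟨(k, a, b), h⟩) else 0

/-- The reduced echelon matrices of the point of the cell with given coordinates. -/
noncomputable def pointCoef (I : Fin (N / 2) → Finset (Fin N)) (t : Fin (freeSet I).card → ℂ)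
    (k : Fin (N / 2)) (a b : Fin N) : ℂ :=
  MvPolynomial.eval t (genericCoef I k a b)

lemma pointCoef_isValid (hI : I ∈ indexSet N) (t : Fin (freeSet I).card → ℂ) :
    IsValid I (pointCoef I t) :=
  (coef_isValid hI).map (MvPolynomial.eval t)

lemma pointCoef_of_free (t : Fin (freeSet I).card → ℂ) (q : freeSet I) :
    pointCoef I t q.1.1 q.1.2.1 q.1.2.2 = t ((freeSet I).equivFin q) := by
  rw [pointCoef, genericCoef, coef_of_free (mem_freeSet.mp q.2), dif_pos q.2, MvPolynomial.eval_X]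

/-- The parametrization of a cell by an affine space. -/
noncomputable def cellEquiv (hI : I ∈ indexSet N) : (Fin (freeSet I).card → ℂ) ≃ cell N I where
  toFun t := ⟨spanColl I (pointCoef I t), (pointCoef_isValid hI t).spanColl_mem_cell hI.1⟩
  invFun V := fun j => redCoef (V : Coll N) ((freeSet I).equivFin.symm j).1.1
    ((freeSet I).equivFin.symm j).1.2.1 ((freeSet I).equivFin.symm j).1.2.2
  left_inv t := by
    funext j
    have h := mem_freeSet.mp ((freeSet I).equivFin.symm j).2
    simp only
    rw [(pointCoef_isValid hI t).redCoef_spanColl h.1, pointCoef_of_free, Equiv.apply_symm_apply]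
  right_inv V := by
    apply Subtype.ext
    conv_rhs => rw [← spanColl_redCoef V.2]
    funext k
    simp only [spanColl]
    congr 1
    refine Set.image_congr fun a ha => funext fun b => ?_
    -- Both families are valid and share their free entries.
    refine (pointCoef_isValid hI _).eq_of_free hI (redCoef_isValid V.2) ?_ (N / 2 - (k + 1)) k
      (by omega) a ha b
    intro k a b hf
    have := pointCoef_of_free (I := I) (fun j => redCoef (V : Coll N)
      ((freeSet I).equivFin.symm j).1.1 ((freeSet I).equivFin.symm j).1.2.1
      ((freeSet I).equivFin.symm j).1.2.2) ⟨(k, a, b), mem_freeSet.mpr hf⟩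
    rw [this, Equiv.symm_apply_apply]

/-- The cells are affine cells. -/
theorem isAffineCell_cell (hI : I ∈ indexSet N) :
    IsAffineCell N (freeSet I).card (cell N I) := by
  refine ⟨isZariskiLocallyClosed_cell hI.1, cellEquiv hI, fun t₀ => ?_, fun j => ?_⟩
  · have e : ∀ k : Fin (N / 2), Fin ((k : ℕ) + 1) ≃ I k := fun k =>
      ((I k).equivFinOfCardEq (hI.1 k)).symm
    -- The reduced bases form a polynomial frame on the whole affine space, so no localization is
    -- needed.
    refine ⟨1, fun s => genericCoef I s.1 (e s.1 s.2.2) s.2.1, by simp, fun t _ k => ?_⟩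
    have hframe : frameVec N (fun s => MvPolynomial.eval t
        (genericCoef I s.1 (e s.1 s.2.2) s.2.1)) k = fun j => pointCoef I t k (e k j) := rfl
    rw [hframe]
    have hred := (pointCoef_isValid hI t).red k
    refine ⟨(hred.linearIndependent (rowLabel_injective k)).comp _ (e k).injective, ?_⟩
    change _ = Submodule.span ℂ (pointCoef I t k '' I k)
    rw [Set.image_eq_range]
    congr 1
    exact (e k).surjective.range_comp (fun a : I k => pointCoef I t k a)
  · exact isRegularFunction_redCoef I hI.1 (mem_freeSet.mp ((freeSet I).equivFin.symm j).2).1 _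

end Parametrization

end DegFlag

/-! ### The configuration `S(I)` described by the rows its first columns occupy. -/

namespace DegFlag

variable {N : ℕ} {I : Fin (N / 2) → Finset (Fin N)}

/-- The rows that hold the points in the first `m` columns of the configuration of `I`. -/
def rowsUpTo (I : Fin (N / 2) → Finset (Fin N)) (m : ℕ) : Finset ℕ :=
  Finset.Icc 1 m ∪ (Finset.univ.filter (fun k : Fin (N / 2) => (k : ℕ) + 1 = m)).biUnion
    fun k => (I k).image (rowLabel N k)

/-- The points in the first `n` columns of the configuration of `I`. -/
def leftPoints (N : ℕ) (I : Fin (N / 2) → Finset (Fin N)) : Finset (ℕ × ℕ) :=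
  bluePoints N I ∪ redPoints N I

lemma exists_rowLabel {k : Fin (N / 2)} {i : ℕ} (h1 : (k : ℕ) + 2 ≤ i) (h2 : i ≤ N + k + 1) :
    ∃ b : Fin N, rowLabel N k b = i := by
  have := k.2
  by_cases h : i ≤ N
  · refine ⟨⟨i - 1, by omega⟩, ?_⟩
    simp only [rowLabel]
    split_ifs <;> omega
  · refine ⟨⟨i - N - 1, by omega⟩, ?_⟩
    simp only [rowLabel]
    split_ifs <;> omega

lemma rowLabel_selfdual {k : Fin (N / 2)} (hk : (k : ℕ) + 1 = N / 2) {a : Fin N}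
    (ha : a = Fin.rev a) : rowLabel N k a = N / 2 + 1 ∧ N = 2 * (N / 2) + 1 := by
  have h1 := congrArg Fin.val ha
  have := a.2
  simp only [rowLabel, Fin.val_rev] at *
  split_ifs <;> omega

lemma mem_rowsUpTo_succ (k : Fin (N / 2)) {i : ℕ} :
    i ∈ rowsUpTo I (k + 1) ↔ (1 ≤ i ∧ i ≤ k + 1) ∨ ∃ a ∈ I k, rowLabel N k a = i := by
  simp only [rowsUpTo, Finset.mem_union, Finset.mem_Icc, Finset.mem_biUnion, Finset.mem_filter,
    Finset.mem_univ, true_and, Finset.mem_image]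
  refine or_congr_right ⟨?_, fun h => ⟨k, rfl, h⟩⟩
  rintro ⟨k', hk', h⟩
  obtain rfl : k' = k := Fin.ext (by omega)
  exact h

lemma rowLabel_mem_rowsUpTo {k : Fin (N / 2)} {a : Fin N} :
    rowLabel N k a ∈ rowsUpTo I (k + 1) ↔ a ∈ I k := by
  rw [mem_rowsUpTo_succ]
  constructor
  · rintro (⟨-, h⟩ | ⟨a', ha', h⟩)
    · have := le_rowLabel k a
      omega
    · rwa [← rowLabel_injective k h]
  · exact fun h => Or.inr ⟨a, h, rfl⟩

lemma rowsUpTo_zero : rowsUpTo I 0 = ∅ := by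
  simp [rowsUpTo]

lemma exists_index {m : ℕ} (h1 : 1 ≤ m) (h2 : m ≤ N / 2) : ∃ k : Fin (N / 2), m = k + 1 :=
  ⟨⟨m - 1, by omega⟩, by simp only; omega⟩

lemma mem_rowsUpTo_of_le {m i : ℕ} (h1 : 1 ≤ i) (h2 : i ≤ m) : i ∈ rowsUpTo I m :=
  Finset.mem_union_left _ (Finset.mem_Icc.mpr ⟨h1, h2⟩)

lemma rowsUpTo_bounds {m i : ℕ} (hm : m ≤ N / 2) (hi : i ∈ rowsUpTo I m) :
    1 ≤ i ∧ i ≤ N + m := by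
  rcases Nat.eq_zero_or_pos m with rfl | h
  · simp [rowsUpTo_zero] at hi
  obtain ⟨k, rfl⟩ := exists_index (N := N) h hm
  rcases (mem_rowsUpTo_succ k).mp hi with h | ⟨a, -, rfl⟩
  · omega
  · have := le_rowLabel k a
    have := rowLabel_le k a
    omega

/-- Only one position changes its label in the next order, and its old label is the new end of the
initial interval; the others are handled by the inclusion in the definition of `indexSet`. -/
lemma rowsUpTo_subset_succ (hI : I ∈ indexSet N) {m : ℕ} (hm : m + 1 ≤ N / 2) :
    rowsUpTo I m ⊆ rowsUpTo I (m + 1) := by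
  intro i hi
  rcases Nat.eq_zero_or_pos m with rfl | h
  · simp [rowsUpTo_zero] at hi
  obtain ⟨k, rfl⟩ := exists_index (N := N) h (by omega)
  have hk : (k : ℕ) + 1 < N / 2 := by omega
  refine (mem_rowsUpTo_succ ⟨k + 1, hk⟩).mpr ?_
  rcases (mem_rowsUpTo_succ k).mp hi with h | ⟨a, ha, rfl⟩
  · left
    simp only
    omega
  by_cases hak : (a : ℕ) = k + 1
  · left
    simp only [rowLabel, hak]
    split_ifs <;> omega
  · right
    refine ⟨a, ?_, rowLabel_succ hk hak⟩
    exact (Finset.mem_insert.mp (hI.2.1 k hk ha)).resolve_left fun e => hak (congrArg Fin.val e)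

lemma rowsUpTo_mono (hI : I ∈ indexSet N) {m m' : ℕ} (h : m ≤ m') (hm : m' ≤ N / 2) :
    rowsUpTo I m ⊆ rowsUpTo I m' := by
  induction m', h using Nat.le_induction with
  | base => exact Finset.Subset.refl _
  | succ m' _ ih => exact (ih (by omega)).trans (rowsUpTo_subset_succ hI hm)

lemma card_rowsUpTo (hI : I ∈ indexSet N) {m : ℕ} (hm : m ≤ N / 2) :
    (rowsUpTo I m).card = 2 * m := by
  rcases Nat.eq_zero_or_pos m with rfl | h
  · simp [rowsUpTo_zero]
  obtain ⟨k, rfl⟩ := exists_index (N := N) h hm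
  have : rowsUpTo I (k + 1) = Finset.Icc 1 ((k : ℕ) + 1) ∪ (I k).image (rowLabel N k) := by
    ext i
    rw [mem_rowsUpTo_succ]
    simp
  rw [this, Finset.card_union_of_disjoint, Finset.card_image_of_injective _ (rowLabel_injective k),
    hI.1 k, Nat.card_Icc]
  · omega
  · rw [Finset.disjoint_left]
    intro i hi hi'
    obtain ⟨a, -, rfl⟩ := Finset.mem_image.mp hi'
    have := le_rowLabel k a
    have := (Finset.mem_Icc.mp hi).2
    omega

/-- An initiating position equal to the column index has the label `N + k + 1`, beyond all rows
occupied before. Any other one keeps its label from the previous order, where it was not leading. -/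
lemma initiating_row {k : Fin (N / 2)} {a : Fin N} (h : Initiating N I k a) :
    rowLabel N k a ∈ rowsUpTo I (k + 1) ∧ rowLabel N k a ∉ rowsUpTo I k := by
  refine ⟨rowLabel_mem_rowsUpTo.mpr h.1, fun hmem => ?_⟩
  rcases Nat.eq_zero_or_pos (k : ℕ) with h0 | h0
  · rw [h0, rowsUpTo_zero] at hmem
    simp at hmem
  rcases h.2 with hak | hnot
  · have := (rowsUpTo_bounds (by omega) hmem).2
    simp only [rowLabel, hak, lt_irrefl, if_false] at this
    omega
  · obtain ⟨j, hj⟩ := exists_index (N := N) h0 (by omega : (k : ℕ) ≤ N / 2)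
    by_cases hak : (a : ℕ) = k
    · have := (rowsUpTo_bounds (by omega) hmem).2
      simp only [rowLabel, hak, lt_irrefl, if_false] at this
      omega
    · have hk : k = ⟨j + 1, by omega⟩ := Fin.ext hj
      have e := rowLabel_succ (k := j) (by omega) (a := a) (by omega)
      rw [← hk] at e
      rw [hj, e, rowLabel_mem_rowsUpTo] at hmem
      exact hnot j hj.symm hmem

lemma eq_or_initiating_of_new {k : Fin (N / 2)} {i : ℕ} (h1 : i ∈ rowsUpTo I (k + 1))
    (h2 : i ∉ rowsUpTo I k) : i = k + 1 ∨ ∃ a, Initiating N I k a ∧ rowLabel N k a = i := by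
  rcases (mem_rowsUpTo_succ k).mp h1 with h | ⟨a, ha, rfl⟩
  · left
    by_contra hne
    exact h2 (mem_rowsUpTo_of_le h.1 (by omega))
  · right
    refine ⟨a, ⟨ha, ?_⟩, rfl⟩
    by_cases hak : (a : ℕ) = k
    · exact Or.inl hak
    · refine Or.inr fun j hj haj => h2 ?_
      have hk : k = ⟨j + 1, by omega⟩ := Fin.ext hj.symm
      have e := rowLabel_succ (k := j) (by omega) (a := a) (by omega)
      rw [← hk] at e
      rw [e, ← hj]
      exact rowLabel_mem_rowsUpTo.mpr haj

lemma mem_bluePoints {p : ℕ × ℕ} :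
    p ∈ bluePoints N I ↔ ∃ k a, Initiating N I k a ∧ ((k : ℕ) + 1, rowLabel N k a) = p := by
  simp [bluePoints]

lemma mem_leftPoints (hI : I ∈ indexSet N) {p : ℕ × ℕ} :
    p ∈ leftPoints N I ↔
      1 ≤ p.1 ∧ p.1 ≤ N / 2 ∧ p.2 ∈ rowsUpTo I p.1 ∧ p.2 ∉ rowsUpTo I (p.1 - 1) := by
  rw [leftPoints, Finset.mem_union]
  constructor
  · rintro (h | h)
    · obtain ⟨k, a, hi, rfl⟩ := mem_bluePoints.mp h
      have := k.2
      exact ⟨by simp, by simp only; omega, (initiating_row hi).1, (initiating_row hi).2⟩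
    · obtain ⟨i, hi, rfl⟩ := Finset.mem_image.mp h
      obtain ⟨hi, hblue⟩ := Finset.mem_filter.mp hi
      obtain ⟨h1, h2⟩ := Finset.mem_Icc.mp hi
      -- If row `i` were occupied earlier, its first occurrence would be in a column before `i`,
      -- hence at a blue point, which a red row does not contain.
      refine ⟨h1, h2, mem_rowsUpTo_of_le h1 le_rfl, fun hmem => ?_⟩
      have hex : ∃ m, i ∈ rowsUpTo I m := ⟨i - 1, hmem⟩
      classical
      have hm := Nat.find_spec hex
      have hle : Nat.find hex ≤ i - 1 := Nat.find_min' hex hmem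
      have hpos : 1 ≤ Nat.find hex := by
        by_contra h0
        rw [show Nat.find hex = 0 by omega, rowsUpTo_zero] at hm
        simp at hm
      obtain ⟨k, hk⟩ := exists_index (N := N) hpos (by omega)
      have hnot : i ∉ rowsUpTo I k := Nat.find_min hex (by omega)
      rw [hk] at hm
      rcases eq_or_initiating_of_new hm hnot with h | ⟨a, ha, hr⟩
      · omega
      · exact hblue _ (mem_bluePoints.mpr ⟨k, a, ha, rfl⟩) hr
  · obtain ⟨j, i⟩ := p
    rintro ⟨h1, h2, h3, h4⟩
    simp only at h1 h2 h3 h4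
    obtain ⟨k, rfl⟩ := exists_index (N := N) h1 h2
    rcases eq_or_initiating_of_new h3 h4 with rfl | ⟨a, ha, rfl⟩
    · right
      refine Finset.mem_image.mpr ⟨k + 1, Finset.mem_filter.mpr
        ⟨Finset.mem_Icc.mpr ⟨h1, h2⟩, fun p hp hpk => h4 ?_⟩, rfl⟩
      -- Blue points lie strictly below the diagonal, so a blue point in row `k + 1` would lie in an
      -- earlier column and the row would not be new.
      obtain ⟨k', a, hi, rfl⟩ := mem_bluePoints.mp hp
      simp only at hpk
      have := le_rowLabel k' a
      rw [← hpk]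
      exact rowsUpTo_mono hI (by omega) (by omega)
        (initiating_row hi).1
    · exact Or.inl (mem_bluePoints.mpr ⟨k, a, ha, rfl⟩)

lemma leftPoints_row_injective (hI : I ∈ indexSet N) {p q : ℕ × ℕ} (hp : p ∈ leftPoints N I)
    (hq : q ∈ leftPoints N I) (h : p.2 = q.2) : p = q := by
  obtain ⟨h1, h2, h3, h4⟩ := (mem_leftPoints hI).mp hp
  obtain ⟨h1', h2', h3', h4'⟩ := (mem_leftPoints hI).mp hq
  refine Prod.ext ?_ h
  rcases lt_trichotomy p.1 q.1 with hlt | heq | hgt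
  · exact absurd (rowsUpTo_mono hI (by omega) (by omega) h3) (h ▸ h4')
  · exact heq
  · exact absurd (rowsUpTo_mono hI (by omega) (by omega) h3') (h ▸ h4)

lemma exists_leftPoint (hI : I ∈ indexSet N) {i m : ℕ} (hm : m ≤ N / 2) (hi : i ∈ rowsUpTo I m) :
    ∃ j ≤ m, (j, i) ∈ leftPoints N I := by
  classical
  have hex : ∃ m, i ∈ rowsUpTo I m := ⟨m, hi⟩
  have hle : Nat.find hex ≤ m := Nat.find_min' hex hi
  have hpos : 1 ≤ Nat.find hex := by
    by_contra h0
    have := Nat.find_spec hex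
    rw [show Nat.find hex = 0 by omega, rowsUpTo_zero] at this
    simp at this
  exact ⟨Nat.find hex, hle, (mem_leftPoints hI).mpr
    ⟨hpos, by simp only; omega, Nat.find_spec hex, Nat.find_min hex (by simp only; omega)⟩⟩

lemma leftPoints_row (hI : I ∈ indexSet N) {p : ℕ × ℕ} (hp : p ∈ leftPoints N I) :
    p.2 ∈ rowsUpTo I (N / 2) := by
  obtain ⟨-, h2, h3, -⟩ := (mem_leftPoints hI).mp hp
  exact rowsUpTo_mono hI h2 le_rfl h3

lemma leftPoints_bounds (hI : I ∈ indexSet N) {p : ℕ × ℕ} (hp : p ∈ leftPoints N I) :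
    1 ≤ p.1 ∧ p.1 ≤ N / 2 ∧ p.1 ≤ p.2 ∧ p.2 ≤ N + p.1 := by
  obtain ⟨h1, h2, h3, h4⟩ := (mem_leftPoints hI).mp hp
  obtain ⟨h5, h6⟩ := rowsUpTo_bounds h2 h3
  refine ⟨h1, h2, ?_, h6⟩
  by_contra h
  exact h4 (mem_rowsUpTo_of_le h5 (by omega))

/-- Isotropy: the rows of the points on the left are disjoint from their reflections. -/
lemma reflect_row_not_mem (hI : I ∈ indexSet N) {i : ℕ} (hi : i ∈ rowsUpTo I (N / 2)) :
    2 * N + 1 - i ∉ rowsUpTo I (N / 2) := by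
  intro hi'
  obtain ⟨h1, h2⟩ := rowsUpTo_bounds le_rfl hi
  obtain ⟨h1', h2'⟩ := rowsUpTo_bounds le_rfl hi'
  rcases Nat.eq_zero_or_pos (N / 2) with h0 | h0
  · rw [h0, rowsUpTo_zero] at hi
    simp at hi
  obtain ⟨k, hk⟩ := exists_index (N := N) h0 le_rfl
  rw [hk, mem_rowsUpTo_succ] at hi hi'
  rcases hi with h | ⟨a, ha, rfl⟩
  · omega
  rcases hi' with h | ⟨a', ha', he⟩
  · omega
  by_cases hra : a = Fin.rev a
  · have := rowLabel_selfdual hk.symm hra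
    omega
  · have := rowLabel_rev hk.symm hra
    have e : a' = Fin.rev a := rowLabel_injective k (by omega)
    exact hI.2.2 k hk.symm a ha hra (e ▸ ha')

/-- The rows of the points in the middle column. -/
def middleRows (I : Fin (N / 2) → Finset (Fin N)) : Finset ℕ :=
  (Finset.Icc 1 (2 * N)).filter fun i =>
    i ∉ rowsUpTo I (N / 2) ∧ 2 * N + 1 - i ∉ rowsUpTo I (N / 2)

/-- The rows on the left and their reflections are disjoint sets of `2 * (N / 2)` rows each. So no
row remains for even `N`, and two remain for odd `N`. -/
lemma card_middleRows (hI : I ∈ indexSet N) : (middleRows I).card + 4 * (N / 2) = 2 * N := by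
  have hb := fun i (hi : i ∈ rowsUpTo I (N / 2)) => rowsUpTo_bounds le_rfl hi
  have hsplit : Finset.Icc 1 (2 * N) = middleRows I ∪
      (rowsUpTo I (N / 2) ∪ (rowsUpTo I (N / 2)).image fun i => 2 * N + 1 - i) := by
    ext i
    simp only [middleRows, Finset.mem_union, Finset.mem_filter, Finset.mem_image, Finset.mem_Icc]
    constructor
    · intro h
      by_cases h1 : i ∈ rowsUpTo I (N / 2)
      · exact Or.inr (Or.inl h1)
      by_cases h2 : 2 * N + 1 - i ∈ rowsUpTo I (N / 2)
      · exact Or.inr (Or.inr ⟨_, h2, by omega⟩)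
      · exact Or.inl ⟨h, h1, h2⟩
    · rintro (h | h | ⟨j, h, rfl⟩)
      · exact h.1
      · have := hb i h
        omega
      · have := hb j h
        omega
  have hcard := congrArg Finset.card hsplit
  rw [Nat.card_Icc, Finset.card_union_of_disjoint, Finset.card_union_of_disjoint,
    Finset.card_image_of_injOn, card_rowsUpTo hI le_rfl] at hcard
  · omega
  · intro i hi j hj h
    have := hb i hi
    have := hb j hj
    simp only at h
    omega
  · rw [Finset.disjoint_left]
    intro i hi hi'
    obtain ⟨j, hj, rfl⟩ := Finset.mem_image.mp hi'
    exact reflect_row_not_mem hI hj hi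
  · rw [Finset.disjoint_left]
    intro i hi hi'
    obtain ⟨-, h1, h2⟩ := Finset.mem_filter.mp hi
    rcases Finset.mem_union.mp hi' with h | h
    · exact h1 h
    · obtain ⟨j, hj, rfl⟩ := Finset.mem_image.mp h
      have := hb j hj
      rw [show 2 * N + 1 - (2 * N + 1 - j) = j by omega] at h2
      exact h2 hj

lemma reflect_reflect {p : ℕ × ℕ} (h1 : p.1 ≤ N) (h2 : p.2 ≤ 2 * N) :
    reflect N (reflect N p) = p := by
  ext <;> simp only [reflect] <;> omega

lemma mem_outerPoints (hI : I ∈ indexSet N) {p : ℕ × ℕ} :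
    p ∈ outerPoints N I ↔
      p ∈ leftPoints N I ∨ (p.1 ≤ N ∧ p.2 ≤ 2 * N ∧ reflect N p ∈ leftPoints N I) := by
  rw [outerPoints, ← leftPoints, Finset.mem_union, Finset.mem_image]
  refine or_congr_right ⟨?_, fun h => ⟨_, h.2.2, reflect_reflect h.1 h.2.1⟩⟩
  rintro ⟨q, hq, rfl⟩
  have := leftPoints_bounds hI hq
  refine ⟨by simp only [reflect]; omega, by simp only [reflect]; omega, ?_⟩
  rwa [reflect_reflect (by omega) (by omega)]

lemma outerPoints_row_iff (hI : I ∈ indexSet N) {i : ℕ} (hi : i ∈ Finset.Icc 1 (2 * N)) :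
    (∃ p ∈ outerPoints N I, p.2 = i) ↔
      i ∈ rowsUpTo I (N / 2) ∨ 2 * N + 1 - i ∈ rowsUpTo I (N / 2) := by
  rw [Finset.mem_Icc] at hi
  constructor
  · rintro ⟨p, hp, rfl⟩
    rcases (mem_outerPoints hI).mp hp with h | ⟨-, -, h⟩
    · exact Or.inl (leftPoints_row hI h)
    · exact Or.inr (leftPoints_row hI h)
  · rintro (h | h)
    · obtain ⟨j, -, hj⟩ := exists_leftPoint hI le_rfl h
      exact ⟨_, (mem_outerPoints hI).mpr (Or.inl hj), rfl⟩
    · obtain ⟨j, -, hj⟩ := exists_leftPoint hI le_rfl h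
      have := leftPoints_bounds hI hj
      simp only at this
      refine ⟨(N + 1 - j, i), (mem_outerPoints hI).mpr (Or.inr ⟨?_, hi.2, ?_⟩), rfl⟩
      · simp only
        omega
      · rwa [reflect, show N + 1 - (N + 1 - j) = j by omega]

lemma mem_dellac (hI : I ∈ indexSet N) {p : ℕ × ℕ} :
    p ∈ dellac N I ↔ p ∈ leftPoints N I ∨
      (p.1 ≤ N ∧ p.2 ≤ 2 * N ∧ reflect N p ∈ leftPoints N I) ∨
      (p.1 = N / 2 + 1 ∧ p.2 ∈ middleRows I) := by
  rw [dellac, Finset.mem_union, mem_outerPoints hI, or_assoc]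
  refine or_congr_right (or_congr_right ?_)
  have hfilter : (Finset.Icc 1 (2 * N)).filter (fun i => ∀ p ∈ outerPoints N I, p.2 ≠ i) =
      middleRows I := by
    refine Finset.filter_congr fun i hi => ?_
    rw [← not_or, ← outerPoints_row_iff hI hi]
    push Not
    rfl
  split_ifs with hN
  · rw [hfilter, Finset.mem_image]
    constructor
    · rintro ⟨i, hi, rfl⟩
      exact ⟨rfl, hi⟩
    · rintro ⟨h1, h2⟩
      exact ⟨p.2, h2, Prod.ext h1.symm rfl⟩
  · have hcard := card_middleRows hI
    have hodd : ¬ N % 2 = 1 := fun h => hN (Nat.odd_iff.mpr h)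
    have : middleRows I = ∅ := Finset.card_eq_zero.mp (by omega)
    simp [this]

lemma middleRows_bounds (hI : I ∈ indexSet N) {i : ℕ} (hi : i ∈ middleRows I) :
    N = 2 * (N / 2) + 1 ∧ N / 2 + 1 ≤ i ∧ i ≤ 2 * N - N / 2 := by
  obtain ⟨h0, h1, h2⟩ := Finset.mem_filter.mp hi
  rw [Finset.mem_Icc] at h0
  have hcard := card_middleRows hI
  have : 1 ≤ (middleRows I).card := Finset.card_pos.mpr ⟨i, hi⟩
  refine ⟨by omega, ?_, ?_⟩
  · by_contra h
    exact h1 (mem_rowsUpTo_of_le h0.1 (by omega))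
  · by_contra h
    exact h2 (mem_rowsUpTo_of_le (by omega) (by omega))

lemma dellac_inside (hI : I ∈ indexSet N) {p : ℕ × ℕ} (hp : p ∈ dellac N I) :
    1 ≤ p.1 ∧ p.1 ≤ N ∧ p.1 ≤ p.2 ∧ p.2 ≤ N + p.1 := by
  rcases (mem_dellac hI).mp hp with h | ⟨h1, h2, h⟩ | ⟨h1, h2⟩
  · have := leftPoints_bounds hI h
    omega
  · have := leftPoints_bounds hI h
    simp only [reflect] at this
    omega
  · have := middleRows_bounds hI h2
    omega

lemma reflect_mem_dellac (hI : I ∈ indexSet N) {p : ℕ × ℕ} (hp : p ∈ dellac N I) :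
    reflect N p ∈ dellac N I := by
  have hb := dellac_inside hI hp
  rw [mem_dellac hI, reflect_reflect (by omega) (by omega)]
  rcases (mem_dellac hI).mp hp with h | ⟨-, -, h⟩ | ⟨h1, h2⟩
  · exact Or.inr (Or.inl ⟨by simp only [reflect]; omega, by simp only [reflect]; omega, h⟩)
  · exact Or.inl h
  · have := middleRows_bounds hI h2
    refine Or.inr (Or.inr ⟨by simp only [reflect]; omega, ?_⟩)
    obtain ⟨h0, h3, h4⟩ := Finset.mem_filter.mp h2
    rw [Finset.mem_Icc] at h0
    refine Finset.mem_filter.mpr ⟨?_, h4, ?_⟩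
    · simp only [reflect, Finset.mem_Icc]
      omega
    · rwa [reflect, show 2 * N + 1 - (2 * N + 1 - p.2) = p.2 by omega]

lemma mem_leftPoints_of_dellac (hI : I ∈ indexSet N) {p : ℕ × ℕ} (hp : p ∈ dellac N I)
    (h : p.1 ≤ N / 2) : p ∈ leftPoints N I := by
  rcases (mem_dellac hI).mp hp with h' | ⟨-, -, h'⟩ | ⟨h', -⟩
  · exact h'
  · have := leftPoints_bounds hI h'
    have := dellac_inside hI hp
    simp only [reflect] at *
    omega
  · omega

/-- Whether a row or its reflection belongs to the rows of the left part tells in which of the three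
parts its point lies. -/
lemma dellac_row_injective (hI : I ∈ indexSet N) {p q : ℕ × ℕ} (hp : p ∈ dellac N I)
    (hq : q ∈ dellac N I) (h : p.2 = q.2) : p = q := by
  have key : ∀ {p : ℕ × ℕ}, p ∈ dellac N I →
      (p ∈ leftPoints N I ∧ p.2 ∈ rowsUpTo I (N / 2) ∧ 2 * N + 1 - p.2 ∉ rowsUpTo I (N / 2)) ∨
      (reflect N p ∈ leftPoints N I ∧ p.2 ∉ rowsUpTo I (N / 2) ∧
        2 * N + 1 - p.2 ∈ rowsUpTo I (N / 2)) ∨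
      (p.1 = N / 2 + 1 ∧ p.2 ∉ rowsUpTo I (N / 2) ∧ 2 * N + 1 - p.2 ∉ rowsUpTo I (N / 2)) := by
    intro p hp
    rcases (mem_dellac hI).mp hp with h | ⟨_, h2, h⟩ | ⟨h, h'⟩
    · have := leftPoints_row hI h
      exact Or.inl ⟨h, this, reflect_row_not_mem hI this⟩
    · have : 2 * N + 1 - p.2 ∈ rowsUpTo I (N / 2) := leftPoints_row hI h
      refine Or.inr (Or.inl ⟨h, ?_, this⟩)
      have := reflect_row_not_mem hI this
      rwa [show 2 * N + 1 - (2 * N + 1 - p.2) = p.2 by omega] at this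
    · exact Or.inr (Or.inr ⟨h, (Finset.mem_filter.mp h').2⟩)
  have hbp := dellac_inside hI hp
  have hbq := dellac_inside hI hq
  rcases key hp with ⟨h1, h2, h3⟩ | ⟨h1, h2, h3⟩ | ⟨h1, h2, h3⟩ <;>
  rcases key hq with ⟨h1', h2', h3'⟩ | ⟨h1', h2', h3'⟩ | ⟨h1', h2', h3'⟩ <;>
  rw [h] at h2 h3
  · exact leftPoints_row_injective hI h1 h1' h
  · exact absurd h2 h2'
  · exact absurd h2 h2'
  · exact absurd h2' h2
  · have := leftPoints_row_injective hI h1 h1' (by simp only [reflect, h])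
    rw [← reflect_reflect (N := N) (p := p) (by omega) (by omega), this,
      reflect_reflect (by omega) (by omega)]
  · exact absurd h3 h3'
  · exact absurd h2' h2
  · exact absurd h3' h3
  · exact Prod.ext (h1.trans h1'.symm) h

lemma exists_dellac_row (hI : I ∈ indexSet N) {i : ℕ} (hi : i ∈ Finset.Icc 1 (2 * N)) :
    ∃ p ∈ dellac N I, p.2 = i := by
  by_cases h : i ∈ rowsUpTo I (N / 2) ∨ 2 * N + 1 - i ∈ rowsUpTo I (N / 2)
  · obtain ⟨p, hp, rfl⟩ := (outerPoints_row_iff hI hi).mpr h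
    exact ⟨p, Finset.mem_union_left _ hp, rfl⟩
  · push Not at h
    exact ⟨(N / 2 + 1, i), (mem_dellac hI).mpr
      (Or.inr (Or.inr ⟨rfl, Finset.mem_filter.mpr ⟨hi, h⟩⟩)), rfl⟩

lemma card_leftColumn (hI : I ∈ indexSet N) {j : ℕ} (h1 : 1 ≤ j) (h2 : j ≤ N / 2) :
    ((dellac N I).filter (fun p => p.1 = j)).card = 2 := by
  have : (dellac N I).filter (fun p => p.1 = j) =
      (rowsUpTo I j \ rowsUpTo I (j - 1)).image fun i => (j, i) := by
    ext p
    simp only [Finset.mem_filter, Finset.mem_image, Finset.mem_sdiff]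
    constructor
    · rintro ⟨hp, rfl⟩
      exact ⟨p.2, ((mem_leftPoints hI).mp (mem_leftPoints_of_dellac hI hp h2)).2.2, rfl⟩
    · rintro ⟨i, hi, rfl⟩
      exact ⟨(mem_dellac hI).mpr (Or.inl ((mem_leftPoints hI).mpr ⟨h1, h2, hi⟩)), rfl⟩
  rw [this, Finset.card_image_of_injective _ fun x y h => (Prod.ext_iff.mp h).2,
    Finset.card_sdiff_of_subset (rowsUpTo_mono hI (by omega) h2), card_rowsUpTo hI h2,
    card_rowsUpTo hI (by omega)]
  omega

/-- The configuration attached to an admissible collection is a symmetric Dellac configuration. -/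
theorem dellac_mem_SDC (hI : I ∈ indexSet N) : dellac N I ∈ SDC N := by
  refine ⟨⟨fun p hp => dellac_inside hI hp, fun i hi => ?_, fun j hj => ?_⟩, ?_⟩
  · obtain ⟨p, hp, rfl⟩ := exists_dellac_row hI hi
    refine Finset.card_eq_one.mpr ⟨p, ?_⟩
    ext q
    simp only [Finset.mem_filter, Finset.mem_singleton]
    refine ⟨fun h => dellac_row_injective hI h.1 hp h.2, ?_⟩
    rintro rfl
    exact ⟨hp, rfl⟩
  · rw [Finset.mem_Icc] at hj
    by_cases h1 : j ≤ N / 2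
    · exact card_leftColumn hI hj.1 h1
    by_cases h2 : N + 1 - j ≤ N / 2
    · rw [← card_leftColumn hI (j := N + 1 - j) (by omega) h2]
      refine Finset.card_nbij' (reflect N) (reflect N) ?_ ?_ ?_ ?_
      · intro p hp
        obtain ⟨hp', he⟩ := Finset.mem_filter.mp hp
        exact Finset.mem_filter.mpr ⟨reflect_mem_dellac hI hp', by simp only [reflect, he]⟩
      · intro p hp
        obtain ⟨hp', he⟩ := Finset.mem_filter.mp hp
        have := dellac_inside hI hp'
        refine Finset.mem_filter.mpr ⟨reflect_mem_dellac hI hp', ?_⟩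
        simp only [reflect]
        omega
      all_goals
        intro p hp
        have := dellac_inside hI (Finset.mem_filter.mp hp).1
        exact reflect_reflect (by omega) (by omega)
    · have hcard := card_middleRows hI
      have : (dellac N I).filter (fun p => p.1 = j) = (middleRows I).image fun i => (j, i) := by
        ext p
        simp only [Finset.mem_filter, Finset.mem_image]
        constructor
        · rintro ⟨hp, rfl⟩
          rcases (mem_dellac hI).mp hp with h | ⟨-, -, h⟩ | h
          · have := leftPoints_bounds hI h
            omega
          · have := leftPoints_bounds hI h
            simp only [reflect] at this
            omega
          · exact ⟨p.2, h.2, rfl⟩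
        · rintro ⟨i, hi, rfl⟩
          exact ⟨(mem_dellac hI).mpr (Or.inr (Or.inr ⟨by simp only; omega, hi⟩)), rfl⟩
      rw [this, Finset.card_image_of_injective _ fun x y h => (Prod.ext_iff.mp h).2]
      omega
  · ext p
    rw [Finset.mem_image]
    constructor
    · rintro ⟨q, hq, rfl⟩
      exact reflect_mem_dellac hI hq
    · intro hp
      have := dellac_inside hI hp
      exact ⟨_, reflect_mem_dellac hI hp, reflect_reflect (by omega) (by omega)⟩

end DegFlag

/-! ### Free entries and inversions. -/

namespace DegFlag

variable {N : ℕ} {I : Fin (N / 2) → Finset (Fin N)}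

/-- Representatives of the inversions that are not centrally symmetric modulo reflection. -/
def halfInversions (N : ℕ) (I : Fin (N / 2) → Finset (Fin N)) : Finset ((ℕ × ℕ) × (ℕ × ℕ)) :=
  (asymInversions N (dellac N I)).filter fun q =>
    q.1.1 ≤ N / 2 ∧ (q.2.1 ≤ N - N / 2 ∨ 2 * N + 1 < q.1.2 + q.2.2)

lemma mem_asymInversions {D : Finset (ℕ × ℕ)} {q : (ℕ × ℕ) × (ℕ × ℕ)} :
    q ∈ asymInversions N D ↔ q.1 ∈ D ∧ q.2 ∈ D ∧ q.1.1 < q.2.1 ∧ q.2.2 < q.1.2 ∧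
      q.2 ≠ reflect N q.1 := by
  simp [asymInversions, and_assoc]

/-- The involution `(p, p') ↦ (R p', R p)` replaces the sum of the two rows by `4 * N + 2` minus it.
A pair with `p` left and `p'` right is therefore chosen by this sum; otherwise exactly one of the
two pairs has `p` on the left and `p'` on the left or in the middle. -/
lemma card_asymInversions (hI : I ∈ indexSet N) :
    (asymInversions N (dellac N I)).card = 2 * (halfInversions N I).card := by
  set ρ : (ℕ × ℕ) × (ℕ × ℕ) → (ℕ × ℕ) × (ℕ × ℕ) := fun q => (reflect N q.2, reflect N q.1)
    with hρ
  have hb := fun p (hp : p ∈ dellac N I) => dellac_inside hI hp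
  have hmaps : ∀ q ∈ asymInversions N (dellac N I), ρ q ∈ asymInversions N (dellac N I) ∧
      ρ (ρ q) = q := by
    intro q hq
    obtain ⟨h1, h2, h3, h4, h5⟩ := mem_asymInversions.mp hq
    have b1 := hb _ h1
    have b2 := hb _ h2
    refine ⟨mem_asymInversions.mpr ⟨reflect_mem_dellac hI h2, reflect_mem_dellac hI h1, ?_, ?_,
      ?_⟩, ?_⟩
    · simp only [hρ, reflect]
      omega
    · simp only [hρ, reflect]
      omega
    · simp only [hρ]
      rw [reflect_reflect (by omega) (by omega)]
      exact h5.symm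
    · simp only [hρ]
      rw [reflect_reflect (by omega) (by omega), reflect_reflect (by omega) (by omega)]
  have hsplit : asymInversions N (dellac N I) =
      halfInversions N I ∪ (halfInversions N I).image ρ := by
    ext q
    rw [Finset.mem_union, Finset.mem_image]
    constructor
    · intro hq
      by_cases hh : q ∈ halfInversions N I
      · exact Or.inl hh
      refine Or.inr ⟨ρ q, Finset.mem_filter.mpr ⟨(hmaps q hq).1, ?_⟩, (hmaps q hq).2⟩
      have hh' : ¬ (q.1.1 ≤ N / 2 ∧ (q.2.1 ≤ N - N / 2 ∨ 2 * N + 1 < q.1.2 + q.2.2)) :=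
        fun h => hh (Finset.mem_filter.mpr ⟨hq, h⟩)
      obtain ⟨h1, h2, h3, h4, h5⟩ := mem_asymInversions.mp hq
      have b1 := hb _ h1
      have b2 := hb _ h2
      -- With one point in each row, the critical sum occurs only for centrally symmetric pairs.
      have hne : q.1.2 + q.2.2 ≠ 2 * N + 1 := fun e => h5
        (dellac_row_injective hI h2 (reflect_mem_dellac hI h1) (by simp only [reflect]; omega))
      simp only [hρ, reflect]
      omega
    · rintro (h | ⟨q', h, rfl⟩)
      · exact (Finset.mem_filter.mp h).1
      · exact (hmaps q' (Finset.mem_filter.mp h).1).1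
  rw [hsplit, Finset.card_union_of_disjoint, Finset.card_image_of_injOn]
  · ring
  · intro q hq q' hq' h
    rw [← (hmaps q (Finset.mem_filter.mp hq).1).2, ← (hmaps q' (Finset.mem_filter.mp hq').1).2]
    exact congrArg ρ h
  · rw [Finset.disjoint_left]
    intro q hq hq'
    obtain ⟨q', hq2, rfl⟩ := Finset.mem_image.mp hq'
    obtain ⟨h1, h2⟩ := Finset.mem_filter.mp hq
    obtain ⟨h1', h2'⟩ := Finset.mem_filter.mp hq2
    obtain ⟨h3, h4, -⟩ := mem_asymInversions.mp h1'
    have b1 := hb _ h3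
    have b2 := hb _ h4
    simp only [hρ, reflect] at h2
    omega

lemma IsFree.row_mem {k : Fin (N / 2)} {a b : Fin N} (h : IsFree I k a b) :
    rowLabel N k b ∉ rowsUpTo I (k + 1) ∧
      ((k : ℕ) + 1 < N / 2 → rowLabel N k b ∈ rowsUpTo I (k + 2)) := by
  refine ⟨fun hmem => h.2.1 (rowLabel_mem_rowsUpTo.mp hmem), fun hk => ?_⟩
  by_cases hb : (b : ℕ) = k + 1
  · apply mem_rowsUpTo_of_le <;> simp only [rowLabel, hb] <;> split_ifs <;> omega
  · rw [← rowLabel_succ hk hb]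
    refine (rowLabel_mem_rowsUpTo (k := ⟨k + 1, hk⟩)).mpr ?_
    exact (Finset.mem_insert.mp (h.2.2.2.1 hk)).resolve_left fun e => hb (congrArg Fin.val e)

/-- The index `k` is recovered from the row of `b`: this row is vacant in the first `k + 1` columns
and, below the top, occupied once the next column is added. -/
lemma freeSet_label_injOn (hI : I ∈ indexSet N) :
    Set.InjOn (fun q : Fin (N / 2) × Fin N × Fin N =>
      (rowLabel N q.1 q.2.1, rowLabel N q.1 q.2.2)) (freeSet I) := by
  have key : ∀ q ∈ freeSet I, ∀ q' ∈ freeSet I, rowLabel N q.1 q.2.2 = rowLabel N q'.1 q'.2.2 →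
      ¬ (q.1 : ℕ) < q'.1 := by
    intro q hq q' hq' h hlt
    have := q'.1.2
    have h1 := (mem_freeSet.mp hq).row_mem.2 (by omega)
    refine (mem_freeSet.mp hq').row_mem.1 ?_
    rw [← h]
    exact rowsUpTo_mono hI (by omega) (by omega) h1
  rintro ⟨k, a, b⟩ hq ⟨k', a', b'⟩ hq' h
  obtain ⟨h1, h2⟩ := Prod.ext_iff.mp h
  have e1 := key _ hq _ hq' h2
  have e2 := key _ hq' _ hq h2.symm
  simp only at e1 e2 h1 h2
  obtain rfl : k = k' := Fin.ext (by omega)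
  rw [rowLabel_injective k h1, rowLabel_injective k h2]

lemma exists_inversion_of_free (hI : I ∈ indexSet N) {k : Fin (N / 2)} {a b : Fin N}
    (h : IsFree I k a b) :
    ∃ q ∈ halfInversions N I, (q.1.2, q.2.2) = (rowLabel N k a, rowLabel N k b) := by
  have hkN := k.2
  obtain ⟨j, hj, hp⟩ := exists_leftPoint hI (by omega) (rowLabel_mem_rowsUpTo.mpr h.1)
  have bp := leftPoints_bounds hI hp
  have hpD : (j, rowLabel N k a) ∈ dellac N I := (mem_dellac hI).mpr (Or.inl hp)
  have hlt := h.2.2.1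
  simp only at bp
  by_cases hk : (k : ℕ) + 1 < N / 2
  · obtain ⟨j', hj', hp'⟩ := exists_leftPoint hI (by omega) (h.row_mem.2 hk)
    have hjk : ¬ j' ≤ k + 1 := fun hle => h.row_mem.1
      (rowsUpTo_mono hI hle (by omega) ((mem_leftPoints hI).mp hp').2.2.1)
    refine ⟨((j, rowLabel N k a), (j', rowLabel N k b)), Finset.mem_filter.mpr
      ⟨mem_asymInversions.mpr ⟨hpD, (mem_dellac hI).mpr (Or.inl hp'), ?_, hlt, fun e => ?_⟩,
        ?_⟩, rfl⟩
    · simp only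
      omega
    · have := (Prod.ext_iff.mp e).1
      simp only [reflect] at this
      omega
    · simp only
      omega
  · have hk' : (k : ℕ) + 1 = N / 2 := by omega
    have l1 := le_rowLabel k b
    have l2 := rowLabel_le k b
    have l3 := rowLabel_le k a
    obtain ⟨p', hp', hrow⟩ := exists_dellac_row hI (i := rowLabel N k b)
      (Finset.mem_Icc.mpr ⟨by omega, by omega⟩)
    have hnot := h.row_mem.1
    rw [hk', ← hrow] at hnot
    have hcol : ¬ p'.1 ≤ N / 2 := fun hle =>
      hnot (leftPoints_row hI (mem_leftPoints_of_dellac hI hp' hle))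
    refine ⟨((j, rowLabel N k a), p'), Finset.mem_filter.mpr
      ⟨mem_asymInversions.mpr ⟨hpD, hp', ?_, ?_, fun e => ?_⟩, ?_, ?_⟩, by simp only [hrow]⟩
    · simp only
      omega
    · simp only
      omega
    -- A centrally symmetric pair would force `b` to be the dual of `a`, which the strict inequality
    -- in `IsFree` excludes.
    · have e2 := (Prod.ext_iff.mp e).2
      simp only [reflect, hrow] at e2
      by_cases hra : a = Fin.rev a
      · have := rowLabel_selfdual hk' hra
        omega
      · have := rowLabel_rev hk' hra
        obtain rfl : b = Fin.rev a := rowLabel_injective k (by omega)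
        have := h.2.2.2.2 hk' (by simpa using h.1)
        rw [Fin.rev_rev] at this
        exact lt_irrefl _ this
    · exact bp.2.1
    -- If `p'` lies in the right columns, its reflection puts the dual of `b` into `I k`, and
    -- freeness bounds the label of that dual by the label of `a`: the sum of the rows exceeds `2 *
    -- N + 1`.
    · by_contra hcon
      push Not at hcon
      obtain ⟨hcon1, hcon2⟩ := hcon
      simp only at hcon1 hcon2
      have hrefl := leftPoints_row hI (mem_leftPoints_of_dellac hI (reflect_mem_dellac hI hp')
        (by have := dellac_inside hI hp'; simp only [reflect]; omega))
      simp only [reflect, hrow] at hrefl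
      by_cases hrb : b = Fin.rev b
      · have := rowLabel_selfdual hk' hrb
        have := (rowsUpTo_bounds le_rfl hrefl).2
        omega
      · have e := rowLabel_rev hk' hrb
        rw [show 2 * N + 1 - rowLabel N k b = rowLabel N k (Fin.rev b) by omega, ← hk',
          rowLabel_mem_rowsUpTo] at hrefl
        have := h.2.2.2.2 hk' hrefl
        omega

/-- The second point dictates the index: the column just before it if it lies on the left, and the
last one otherwise. -/
lemma exists_free_of_inversion (hI : I ∈ indexSet N) {q : (ℕ × ℕ) × (ℕ × ℕ)}
    (hq : q ∈ halfInversions N I) :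
    ∃ k a b, IsFree I k a b ∧ (rowLabel N k a, rowLabel N k b) = (q.1.2, q.2.2) := by
  obtain ⟨p, p'⟩ := q
  obtain ⟨hq, hcol, hcond⟩ := Finset.mem_filter.mp hq
  obtain ⟨h1, h2, h3, h4, -⟩ := mem_asymInversions.mp hq
  simp only at hcol hcond h1 h2 h3 h4 ⊢
  have hleft := (mem_leftPoints hI).mp (mem_leftPoints_of_dellac hI h1 hcol)
  have bp := dellac_inside hI h1
  have bp' := dellac_inside hI h2
  -- A row occupied on the left and beyond the initial interval `1, …, k + 1` is the label of an
  -- element of `I k`.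
  have row_of : ∀ k : Fin (N / 2), p.1 ≤ k + 1 → (k : ℕ) + 1 < p.2 →
      ∃ a ∈ I k, rowLabel N k a = p.2 := by
    intro k hk hlt
    have := rowsUpTo_mono hI hk (by omega) hleft.2.2.1
    exact ((mem_rowsUpTo_succ k).mp this).resolve_left (by omega)
  by_cases hc : p'.1 ≤ N / 2
  · obtain ⟨h5, -, h6, h7⟩ := (mem_leftPoints hI).mp (mem_leftPoints_of_dellac hI h2 hc)
    obtain ⟨k, hk⟩ := exists_index (N := N) (m := p'.1 - 1) (by omega) (by omega)
    have hkN : (k : ℕ) + 1 < N / 2 := by omega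
    rw [hk] at h7
    rw [show p'.1 = k + 1 + 1 by omega] at h6
    have hrow : (k : ℕ) + 1 < p'.2 := by
      by_contra hcon
      exact h7 (mem_rowsUpTo_of_le (by omega) (by omega))
    obtain ⟨a, ha, har⟩ := row_of k (by omega) (by omega)
    have hla := rowLabel_le k a
    obtain ⟨b, hb⟩ := exists_rowLabel (k := k) (i := p'.2) (by omega) (by omega)
    refine ⟨k, a, b, ⟨ha, ?_, by omega, fun _ => ?_, fun h => by omega⟩, by rw [har, hb]⟩
    · rw [← hb] at h7
      exact fun hbI => h7 (rowLabel_mem_rowsUpTo.mpr hbI)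
    · by_cases hbk : (b : ℕ) = k + 1
      · exact Finset.mem_insert.mpr (Or.inl (Fin.ext hbk))
      · rw [← hb, ← rowLabel_succ hkN hbk] at h6
        exact Finset.mem_insert_of_mem ((rowLabel_mem_rowsUpTo (k := ⟨k + 1, hkN⟩)).mp h6)
  · obtain ⟨k, hk⟩ := exists_index (N := N) (m := N / 2) (by omega) le_rfl
    have hrows : p'.2 ∉ rowsUpTo I (N / 2) ∧
        (p'.1 ≤ N - N / 2 → 2 * N + 1 - p'.2 ∉ rowsUpTo I (N / 2)) := by
      rcases (mem_dellac hI).mp h2 with h | ⟨-, -, h⟩ | ⟨-, h⟩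
      · exact absurd (leftPoints_bounds hI h).2.1 hc
      · have hr := leftPoints_row hI h
        have hr' := reflect_row_not_mem hI hr
        simp only [reflect] at hr'
        rw [show 2 * N + 1 - (2 * N + 1 - p'.2) = p'.2 by omega] at hr'
        refine ⟨hr', fun hle => ?_⟩
        have := (leftPoints_bounds hI h).2.1
        simp only [reflect] at this
        omega
      · exact ⟨(Finset.mem_filter.mp h).2.1, fun _ => (Finset.mem_filter.mp h).2.2⟩
    have hrow : (k : ℕ) + 1 < p'.2 := by
      by_contra hcon
      exact hrows.1 (mem_rowsUpTo_of_le (by omega) (by omega))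
    obtain ⟨a, ha, har⟩ := row_of k (by omega) (by omega)
    have hla := rowLabel_le k a
    obtain ⟨b, hb⟩ := exists_rowLabel (k := k) (i := p'.2) (by omega) (by omega)
    have hbI : b ∉ I k := fun hbI => by
      have := (rowLabel_mem_rowsUpTo (I := I)).mpr hbI
      rw [hb, ← hk] at this
      exact hrows.1 this
    refine ⟨k, a, b, ⟨ha, hbI, by omega, fun h => by omega, fun _ hrev => ?_⟩, by rw [har, hb]⟩
    have hne : b ≠ Fin.rev b := fun e => hbI (e ▸ hrev)
    have e := rowLabel_rev hk.symm hne
    rcases hcond with hle | hsum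
    · refine absurd ?_ (hrows.2 hle)
      rw [show 2 * N + 1 - p'.2 = rowLabel N k (Fin.rev b) by omega, hk]
      exact rowLabel_mem_rowsUpTo.mpr hrev
    · omega

/-- The number of coordinates on a cell is half of the number of inversions that are not centrally
symmetric. -/
theorem card_freeSet (hI : I ∈ indexSet N) :
    ((freeSet I).card : ℚ) = invTilde' N (dellac N I) := by
  have himage : (freeSet I).image (fun q => (rowLabel N q.1 q.2.1, rowLabel N q.1 q.2.2)) =
      (halfInversions N I).image fun q => (q.1.2, q.2.2) := by
    ext r
    simp only [Finset.mem_image]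
    constructor
    · rintro ⟨q, hq, rfl⟩
      exact exists_inversion_of_free hI (mem_freeSet.mp hq)
    · rintro ⟨q, hq, rfl⟩
      obtain ⟨k, a, b, hf, he⟩ := exists_free_of_inversion hI hq
      exact ⟨(k, a, b), mem_freeSet.mpr hf, he⟩
  have hcard := congrArg Finset.card himage
  rw [Finset.card_image_of_injOn (freeSet_label_injOn hI), Finset.card_image_of_injOn] at hcard
  · rw [invTilde', card_asymInversions hI, hcard]
    push_cast
    ring
  · intro q hq q' hq' h
    obtain ⟨h1, h2, -⟩ := mem_asymInversions.mp (Finset.mem_filter.mp hq).1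
    obtain ⟨h1', h2', -⟩ := mem_asymInversions.mp (Finset.mem_filter.mp hq').1
    obtain ⟨e1, e2⟩ := Prod.ext_iff.mp h
    exact Prod.ext (dellac_row_injective hI h1 h1' e1) (dellac_row_injective hI h2 h2' e2)

end DegFlag

/-! ### The cell decomposition. -/

theorem mainTheorem2 (N : ℕ) :
    (∀ I ∈ DegFlag.indexSet N,
      DegFlag.dellac N I ∈ DegFlag.SDC N ∧
      ∃ d : ℕ, DegFlag.IsAffineCell N d (DegFlag.cell N I) ∧
        (d : ℚ) = DegFlag.invTilde' N (DegFlag.dellac N I)) ∧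
    DegFlag.SOF N = (⋃ I ∈ DegFlag.indexSet N, DegFlag.cell N I) ∧
    (DegFlag.indexSet N).PairwiseDisjoint (DegFlag.cell N) := by
  refine ⟨fun I hI => ⟨DegFlag.dellac_mem_SDC hI, _, DegFlag.isAffineCell_cell hI,
    DegFlag.card_freeSet hI⟩, ?_, ?_⟩
  · ext V
    simp only [Set.mem_iUnion, exists_prop]
    constructor
    · exact fun hV => ⟨_, DegFlag.leadSet_mem_indexSet hV,
        DegFlag.mem_cell_iff.mpr ⟨hV, fun _ => rfl⟩⟩
    · rintro ⟨I, -, hV⟩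
      exact hV.1
  · intro I _ J _ hIJ
    refine Set.disjoint_left.mpr fun V hV hV' => hIJ (funext fun k => ?_)
    rw [← (DegFlag.mem_cell_iff.mp hV).2 k, (DegFlag.mem_cell_iff.mp hV').2 k]
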